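/- Let $F$ be a field of characteristic $0$ with separable closure $F^{\mathrm{sep}}$. Curves below are smooth, projective and geometrically integral, and are identified with their function fields; maps $f\colon X\to\mathbb P^1$ are nonconstant, and isomorphisms of such maps are taken over $\mathbb P^1$ (i.e. they are the identity on the target). A *lax Bely\u{\i} map* is a map $f\colon X\to\mathbb P^1$ ramified above at most three points; it is *Galois* if $F^{\mathrm{sep}}(X)\mid F^{\mathrm{sep}}(\mathbb P^1)$ is a Galois extension. The *field of moduli* of $f$ is the subfield of $F^{\mathrm{sep}}$ fixed by all $\sigma\in\mathrm{Gal}(F^{\mathrm{sep}}\mid F)$ with ${}^\sigma f\simeq f$. A *descent* of a marked map $(X,f;P)$ over $F^{\mathrm{sep}}$ is a marked map $(X_0,f_0;P_0)$ over $F$, with $P_0\in X_0(F)$, whose base extension to $F^{\mathrm{sep}}$ is isomorphic to $(X,f;P)$. **Proposition.** Let $f\colon X\to\mathbb P^1$ be a Galois lax Bely\u{\i} map over $F^{\mathrm{sep}}$ with $X$ of genus $0$, with field of moduli $F$ with respect to $F^{\mathrm{sep}}\mid F$. Let $P\in X(F^{\mathrm{sep}})$ be a point with $f(P)=0$ and ramification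 index $n\ge 2$. (a) There is a model $\mathbb P^1\simeq X$, with coordinates $(x:z)$, such that $P$ corresponds to $\infty=(1:0)$ and the automorphism group of $(X,f;P)$ over $\mathbb P^1$ is generated by $(x:z)\mapsto(\zeta_n x:z)$ with $\zeta_n$ a primitive $n$th root of unity. (b) For every such model, with $t=z/x$, the function $f$ has a power series expansion $f(t)=\sum_{i\ge 1}c_i t^{in}$, and there is a finite subset $I$ of $\{i\ge 1: c_i\ne 0\}$ that generates $\mathbb Z$ as a group. Let $I$ be any such finite subset and let $(b_i)_{i\in I}$ be integers with $\sum_{i\in I}b_i i=1$. Call a representative $(c_{i,0})_{i\in I}$ of the point $c_I=(c_i)_{i\in I}$ of the weighted projective space in which the $i$th coordinate has weight $i$ *normalized* if $\prod_{i\in I}c_{i,0}^{\,b_i}=1$. Then a normalized representative exists, and for every normalized representative $(c_{i,0})_{i\in I}$ there is $\alpha\in (F^{\mathrm{sep}})^\times$ with $c_{i,0}=\alpha^{in}c_i$ for all $i\in I$; this $\alpha$ is unique up to multiplication by an $n$th root of unity. (c) For every such $\alpha$, put $f_0(t)=f(\alpha t)=\sum_{i\ge1}c_{i,0}t^{in}$,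 where $c_{i,0}=\alpha^{in}c_i$ for all $i\ge 1$. Then all coefficients of this power series lie in $F$, the function $f_0$ is a rational function in $F(t)$, and $(\mathbb P^1,f_0;\infty)$, with $\infty=(1:0)$ the point $t=0$, is a descent of $(X,f;P)$. -/

import Mathlib

/-!
Smooth projective curves over a field `k` of characteristic zero are described by their function
fields `L` over `k`, and a nonconstant morphism `X ⟶ ℙ¹` is described by the corresponding
nonconstant function `f` in `L`.  A closed point of the curve is a valuation subring of `L` that
contains `k` and is different from `L`; morphisms of curves are embeddings of function fields in
the opposite direction.
-/

namespace LaxBelyi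

open IntermediateField

/-! ### Curves, points and maps to the projective line -/

/-- `L` is the function field of a geometrically integral curve over the field `k`
(of characteristic zero): it is finite over `k(x)` for some `x` transcendental over `k`, and `k` is
algebraically closed in `L`. -/
structure IsCurve (k L : Type*) [Field k] [Field L] [Algebra k L] : Prop where
  exists_finite : ∃ x : L, Transcendental k x ∧ FiniteDimensional k⟮x⟯ L
  constants : ∀ y : L, IsAlgebraic k y → y ∈ Set.range (algebraMap k L)

/-- The closed points of the smooth projective curve with function field `L` over `k`, given by
their local rings. -/
def IsPoint (k : Type*) {L : Type*} [Field k] [Field L] [Algebra k L]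
    (Q : ValuationSubring L) : Prop :=
  (∀ a : k, algebraMap k L a ∈ Q) ∧ Q ≠ ⊤

/-- The type of closed points of the curve with function field `L` over `k`. -/
abbrev Point (k L : Type*) [Field k] [Field L] [Algebra k L] : Type _ :=
  {Q : ValuationSubring L // IsPoint k Q}

/-- The `k`-rational points: each function regular at `Q` has a value in `k` there. -/
def IsRationalPoint (k : Type*) {L : Type*} [Field k] [Field L] [Algebra k L]
    (Q : ValuationSubring L) : Prop :=
  IsPoint k Q ∧ ∀ x ∈ Q, ∃ a : k, x - algebraMap k L a ∈ Q.nonunits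

/-- `(X, f; P)` is a marked map to the projective line over `k`: `X` is a curve over `k`, `f` is a
nonconstant morphism from `X` to the projective line, and `P` is a `k`-rational point of `X`. -/
structure IsMarkedMap (k : Type*) {L : Type*} [Field k] [Field L] [Algebra k L]
    (f : L) (P : ValuationSubring L) : Prop where
  isCurve : IsCurve k L
  nonconstant : Transcendental k f
  rational : IsRationalPoint k P

/-- The isomorphism of function fields `e` is (the inverse of the pullback along) an isomorphism of
maps to the projective line over `k`, the identity on the target. -/
def IsMapIso {k L L' : Type*} [Field k] [Field L] [Field L'] [Algebra k L] [Algebra k L']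
    (e : L ≃ₐ[k] L') (f : L) (f' : L') : Prop :=
  e f = f'

/-- The isomorphism `e` takes the point `P` to the point `P'`. -/
def MapsPoint {k L L' : Type*} [Field k] [Field L] [Field L'] [Algebra k L] [Algebra k L']
    (e : L ≃ₐ[k] L') (P : ValuationSubring L) (P' : ValuationSubring L') : Prop :=
  ∀ x : L, x ∈ P ↔ e x ∈ P'

/-- The automorphisms of the marked map `(X, f; P)` over `k`. -/
def markedAut (k : Type*) {L : Type*} [Field k] [Field L] [Algebra k L]
    (f : L) (P : ValuationSubring L) : Set (L ≃ₐ[k] L) :=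
  {e | IsMapIso e f f ∧ MapsPoint e P P}

/-! ### Ramification -/

/-- The function `x` is regular at `Q` and vanishes to order `m` there. -/
def HasOrder {L : Type*} [Field L] (Q : ValuationSubring L) (x : L) (m : ℕ) : Prop :=
  ∃ hx : x ∈ Q, Ideal.span {(⟨x, hx⟩ : Q)} = IsLocalRing.maximalIdeal Q ^ m

/-- The pullback along `f` of the standard local parameter at the point `y` of the projective line:
`f - y` for finite `y`, and `1 / f` for `y = ∞`. -/
noncomputable def pullbackParam (k : Type*) {L : Type*} [Field k] [Field L] [Algebra k L]
    (f : L) (y : OnePoint k) : L :=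
  y.elim f⁻¹ (fun a => f - algebraMap k L a)

/-- `f(Q) = y`. -/
def MapsTo (k : Type*) {L : Type*} [Field k] [Field L] [Algebra k L]
    (f : L) (Q : ValuationSubring L) (y : OnePoint k) : Prop :=
  pullbackParam k f y ∈ Q.nonunits

/-- `f(Q) = y`, and the ramification index of `f` at `Q` equals `e`. -/
def HasRamificationIndex (k : Type*) {L : Type*} [Field k] [Field L] [Algebra k L]
    (f : L) (Q : ValuationSubring L) (y : OnePoint k) (e : ℕ) : Prop :=
  MapsTo k f Q y ∧ HasOrder Q (pullbackParam k f y) e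

/-- `y` is a branch point of `f`. -/
def IsBranchPoint (k : Type*) {L : Type*} [Field k] [Field L] [Algebra k L]
    (f : L) (y : OnePoint k) : Prop :=
  ∃ Q : Point k L, MapsTo k f Q.1 y ∧ ¬ HasRamificationIndex k f Q.1 y 1

/-- Over a separably closed field `k`: the map `f` to the projective line is ramified above at most
three points. -/
def IsLaxBelyi (k : Type*) {L : Type*} [Field k] [Field L] [Algebra k L] (f : L) : Prop :=
  Transcendental k f ∧ {y : OnePoint k | IsBranchPoint k f y}.encard ≤ 3

/-- Over a separably closed field `k`: the map `f` to the projective line is (geometrically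
generically) Galois, that is, `L / k(f)` is a Galois extension. -/
def IsGaloisMap (k : Type*) {L : Type*} [Field k] [Field L] [Algebra k L] (f : L) : Prop :=
  IsGalois k⟮f⟯ L

/-! ### The genus -/

/-- Families of functions indexed by the points, regular at all but finitely many of them. -/
def repartitions (k L : Type*) [Field k] [Field L] [Algebra k L] :
    Submodule k (Point k L → L) where
  carrier := {r | {Q : Point k L | r Q ∉ Q.1}.Finite}
  add_mem' := by
    intro r s hr hs
    refine (Set.Finite.union hr hs).subset ?_
    intro Q hQ
    by_contra h
    rw [Set.mem_union, not_or] at h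
    exact hQ (Q.1.add_mem _ _ (not_not.mp h.1) (not_not.mp h.2))
  zero_mem' := Set.finite_empty.subset fun Q hQ => hQ Q.1.zero_mem
  smul_mem' := by
    intro c r hr
    refine Set.Finite.subset hr ?_
    intro Q hQ h
    refine hQ ?_
    simp only [Pi.smul_apply, Algebra.smul_def]
    exact Q.1.mul_mem _ _ (Q.2.1 c) h

/-- Families of functions indexed by the points, regular at all of them. -/
def integralRepartitions (k L : Type*) [Field k] [Field L] [Algebra k L] :
    Submodule k (Point k L → L) where
  carrier := {r | ∀ Q : Point k L, r Q ∈ Q.1}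
  add_mem' := fun hr hs Q => Q.1.add_mem _ _ (hr Q) (hs Q)
  zero_mem' := fun Q => Q.1.zero_mem
  smul_mem' := by
    intro c r hr Q
    simp only [Pi.smul_apply, Algebra.smul_def]
    exact Q.1.mul_mem _ _ (Q.2.1 c) (hr Q)

/-- The constant families. -/
def principalRepartitions (k L : Type*) [Field k] [Field L] [Algebra k L] :
    Submodule k (Point k L → L) :=
  LinearMap.range (LinearMap.pi fun _ : Point k L => (LinearMap.id : L →ₗ[k] L))

/-- The genus of the curve with function field `L` over `k`, that is, the dimension of
`H¹(X, 𝒪_X) = R / (R(0) + L)`, where `R` is the space of repartitions and `R(0)` that of integral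
repartitions. -/
noncomputable def genus (k L : Type*) [Field k] [Field L] [Algebra k L] : Cardinal :=
  Module.rank k (repartitions k L ⧸
    (integralRepartitions k L ⊔ principalRepartitions k L).submoduleOf (repartitions k L))

/-! ### Galois conjugates, field of moduli, descent -/

/-- The function field of the conjugate by `σ` of the curve with function field `L` over `K`: the
same field, with the structure map to it from `K` composed with `σ⁻¹`. -/
def Conj {F K : Type*} [Field F] [Field K] [Algebra F K] (_σ : K ≃ₐ[F] K) (L : Type*) : Type _ := L

instance {F K L : Type*} [Field F] [Field K] [Algebra F K] [Field L] (σ : K ≃ₐ[F] K) :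
    Field (Conj σ L) :=
  inferInstanceAs (Field L)

/-- Conjugation by `σ` on functions; it takes the map `f` to its conjugate. -/
def toConj {F K L : Type*} [Field F] [Field K] [Algebra F K] [Field L] (σ : K ≃ₐ[F] K) :
    L ≃+* Conj σ L :=
  RingEquiv.refl L

instance {F K L : Type*} [Field F] [Field K] [Algebra F K] [Field L] [Algebra K L]
    (σ : K ≃ₐ[F] K) : Algebra K (Conj σ L) :=
  ((toConj σ : L ≃+* Conj σ L).toRingHom.comp
    ((algebraMap K L).comp (σ.symm : K →+* K))).toAlgebra

/-- The conjugate by `σ` of the map `f` is isomorphic to `f` over `K` (and over the projective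
line). -/
def IsConjIso {F K L : Type*} [Field F] [Field K] [Algebra F K] [Field L] [Algebra K L]
    (σ : K ≃ₐ[F] K) (f : L) : Prop :=
  ∃ e : Conj σ L ≃ₐ[K] L, IsMapIso e (toConj σ f) f

/-- The field of moduli of the map `f` with respect to `K / F`: the subfield of `K` fixed by the
automorphisms `σ` of `K / F` such that the conjugate of `f` by `σ` is isomorphic to `f`. -/
def fieldOfModuli (F K : Type*) {L : Type*} [Field F] [Field K] [Algebra F K] [Field L]
    [Algebra K L] (f : L) : IntermediateField F K where
  carrier := {a | ∀ σ : K ≃ₐ[F] K, IsConjIso σ f → σ a = a}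
  mul_mem' := fun ha hb σ h => by rw [map_mul, ha σ h, hb σ h]
  add_mem' := fun ha hb σ h => by rw [map_add, ha σ h, hb σ h]
  algebraMap_mem' := fun r σ _ => σ.commutes r
  inv_mem' := fun a ha σ h => by rw [map_inv₀, ha σ h]

/-- The embedding `ι` identifies `L`, over `K`, with the function field of the base extension to
`K` of the curve with function field `L₀` over `F`; that is, `K ⊗[F] L₀ → L` is injective and `L`
is the field of fractions of its image. -/
structure IsBaseExtension (F K : Type*) {L₀ L : Type*} [Field F] [Field K] [Algebra F K]
    [Field L₀] [Algebra F L₀] [Field L] [Algebra K L] (ι : L₀ →+* L) : Prop where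
  commutes : ∀ a : F, ι (algebraMap F L₀ a) = algebraMap K L (algebraMap F K a)
  linearDisjoint : ∀ s : Set L₀, LinearIndepOn F id s → LinearIndepOn K ι s
  generates : IntermediateField.adjoin K (Set.range ι) = ⊤

/-- `(X₀, f₀; P₀)` is a marked map over `F`, and its base extension to `K` is isomorphic over `K`
to `(X, f; P)`. -/
def IsDescent (F K : Type*) {L₀ L : Type*} [Field F] [Field K] [Algebra F K]
    [Field L₀] [Algebra F L₀] [Field L] [Algebra K L]
    (f₀ : L₀) (P₀ : ValuationSubring L₀) (f : L) (P : ValuationSubring L) : Prop :=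
  IsMarkedMap F f₀ P₀ ∧
    ∃ ι : L₀ →+* L, IsBaseExtension F K ι ∧ ι f₀ = f ∧ ∀ x : L₀, x ∈ P₀ ↔ ι x ∈ P

/-! ### The projective line with coordinate `t = z / x` -/

/-- The point `(x : z) = (1 : 0)` of the projective line over `k`, whose function field is `k(t)`
with `t = z / x`; it is the point `t = 0`. -/
noncomputable def pointInfty (k : Type*) [Field k] : ValuationSubring (RatFunc k) :=
  ((Polynomial.idealX k).valuation (RatFunc k)).valuationSubring

/-- The substitution `f(t) ↦ f(α t)`. -/
noncomputable def scale {k : Type*} [Field k] (α : kˣ) : RatFunc k ≃ₐ[k] RatFunc k :=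
  letI : Invertible (α : k) := α.invertible
  IsFractionRing.fieldEquivOfAlgEquiv k (RatFunc k) (RatFunc k)
    (Polynomial.algEquivCMulXAddC (α : k) 0)

/-- The `m`-th coefficient of the expansion of `f` at `t = 0`. -/
noncomputable def coeffAt {k : Type*} [Field k] (f : RatFunc k) (m : ℤ) : k :=
  (f : LaurentSeries k).coeff m

/-- The inclusion of `F(t)` in `K(t)`. -/
noncomputable def extendScalars (F K : Type*) [Field F] [Field K] [Algebra F K] :
    RatFunc F →+* RatFunc K :=
  RatFunc.mapRingHom (Polynomial.mapRingHom (algebraMap F K))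
    (nonZeroDivisors_le_comap_nonZeroDivisors_of_injective _
      (Polynomial.map_injective _ (algebraMap F K).injective))

/-- The isomorphism `θ` is a model `ℙ¹ ≃ X` of the marked map `(X, f; P)` such that `P` corresponds
to `(1 : 0)` and the automorphism group of `(X, f; P)` is generated by `(x : z) ↦ (ζ x : z)` for a
primitive `n`-th root of unity `ζ`. -/
def IsModel {K L : Type*} [Field K] [Field L] [Algebra K L]
    (f : L) (P : ValuationSubring L) (n : ℕ) (θ : L ≃ₐ[K] RatFunc K) : Prop :=
  MapsPoint θ P (pointInfty K) ∧
    ∃ ζ : Kˣ, IsPrimitiveRoot ζ n ∧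
      markedAut K (θ f) (pointInfty K) =
        (Subgroup.zpowers (scale ζ) : Set (RatFunc K ≃ₐ[K] RatFunc K))

/-! ### Weighted projective points -/

/-- `(c i)` and `(c' i)`, `i ∈ I`, represent the same point of the weighted projective space in
which the coordinate with index `i` has weight `i`. -/
def WeightedEquiv {K : Type*} [Field K] (I : Finset ℕ) (c c' : ℕ → K) : Prop :=
  ∃ μ : Kˣ, ∀ i ∈ I, c' i = (μ : K) ^ i * c i

/-- Let `∑ i ∈ I, b i * i = 1` be a Bézout relation between the weights.  A representative
`(c₀ i)`, `i ∈ I`, of the weighted projective point of `(c i)`, all of whose coordinates are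
nonzero, is normalized if `∏ i ∈ I, c₀ i ^ b i = 1`. -/
def IsNormalizedRepr {K : Type*} [Field K] (I : Finset ℕ) (b : ℕ → ℤ) (c c₀ : ℕ → K) : Prop :=
  WeightedEquiv I c c₀ ∧ ∏ i ∈ I, c₀ i ^ b i = 1

end LaxBelyi

/-! In genus `0` the vanishing of `H¹(X, 𝒪)` gives a function `x` whose only pole is a simple one at
`P`. Functions regular away from `P` are polynomials in `x`, so `x` generates the function field and
whatever fixes `P` acts on `x` by an affine map. The stabilizer of `P` in the Galois group is a
finite group of affine maps; averaging makes it linear, hence cyclic, and comparing orders at `P`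
shows that its order is `n`. This gives the model (`exists_isModel`).

Put `t = x⁻¹`. Invariance under `t ↦ ζ t` leaves only exponents `i * n`. A common divisor `d > 1` of
the occurring `i` would make `t ↦ ξ t`, with `ξ` of order `n * d`, one automorphism too many
(`closure_support_eq_top`). The Bézout product has weight one, so normalizing fixes the weighted
scaling factor `μ`, and `α` is any `n`-th root of `μ`.

If the conjugate of `f` by `σ` is isomorphic to `f`, there is a `σ`-semilinear automorphism of `L`
fixing `f`. The Galois group is transitive on the zeros of `f` (`exists_comap_eq`), so it may be
assumed to fix `P`. It normalizes the cyclic stabilizer, hence, as `n ≥ 2`, fixes the other fixed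
point of that group too, and so it has the form `t ↦ a t`. Thus `c m = a ^ m * σ (c m)`: `σ` changes
the normalized coefficients by a weighted scaling, which the normalization forces to be trivial
(`IsConjIso.apply_coeffAt_scale_eq`). The coefficients therefore lie in the field of moduli `F`, as
do those of the numerator and the denominator. -/

namespace LaxBelyi

open IntermediateField Polynomial algebraAdjoinAdjoin

/-! ### Points as valuation rings, and functions with a single simple pole -/

section Points

variable {k L : Type*} [Field k] [Field L] [Algebra k L]

theorem IsPoint.valuation_algebraMap {Q : ValuationSubring L} (hQ : IsPoint k Q) {a : k}
    (ha : a ≠ 0) : Q.valuation (algebraMap k L a) = 1 := by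
  refine le_antisymm ((Q.valuation_le_one_iff _).2 (hQ.1 a)) ?_
  have h := (Q.valuation_le_one_iff _).2 (hQ.1 a⁻¹)
  rw [map_inv₀, map_inv₀] at h
  have h0 : Q.valuation (algebraMap k L a) ≠ 0 := by simpa using ha
  exact (inv_le_one₀ (zero_lt_iff.2 h0)).1 h

theorem IsPoint.valuation_algebraMap_le {Q : ValuationSubring L} (hQ : IsPoint k Q) (a : k) :
    Q.valuation (algebraMap k L a) ≤ 1 :=
  (Q.valuation_le_one_iff _).2 (hQ.1 a)

/-- An integrally closed subring is the intersection of the valuation rings above it, and a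
valuation ring missing `y` is not `⊤`. This serves as "a function without poles is constant". -/
theorem isAlgebraic_of_forall_mem {y : L} (hy : ∀ Q : ValuationSubring L, IsPoint k Q → y ∈ Q) :
    IsAlgebraic k y := by
  by_contra h
  have hy' : y ∉ (integralClosure k L).toSubring := fun h' => h (IsIntegral.isAlgebraic h')
  have : IsIntegrallyClosedIn (integralClosure k L).toSubring L :=
    inferInstanceAs (IsIntegrallyClosedIn (integralClosure k L) L)
  obtain ⟨V, hV, hyV⟩ := Subring.exists_le_valuationSubring_of_isIntegrallyClosedIn hy'
  refine hyV (hy V ⟨fun a => hV (Subalgebra.algebraMap_mem (integralClosure k L) a), ?_⟩)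
  rintro rfl
  exact hyV (ValuationSubring.mem_top y)

/-- `Q` and its `comap` have different value groups, so only comparisons with `1` are transported.
-/
theorem valuation_comap_le_one_iff {L' : Type*} [Field L'] (Q : ValuationSubring L')
    (e : L →+* L') (y : L) : (Q.comap e).valuation y ≤ 1 ↔ Q.valuation (e y) ≤ 1 := by
  rw [ValuationSubring.valuation_le_one_iff, ValuationSubring.valuation_le_one_iff,
    ValuationSubring.mem_comap]

theorem valuation_comap_lt_one_iff {L' : Type*} [Field L'] (Q : ValuationSubring L')
    (e : L →+* L') (y : L) : (Q.comap e).valuation y < 1 ↔ Q.valuation (e y) < 1 := by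
  rw [← ValuationSubring.mem_nonunits_iff, ← ValuationSubring.mem_nonunits_iff,
    ValuationSubring.mem_nonunits_iff_or, ValuationSubring.mem_nonunits_iff_or,
    ValuationSubring.mem_comap, map_inv₀, map_eq_zero]

theorem valuation_comap_eq_one_iff {L' : Type*} [Field L'] (Q : ValuationSubring L')
    (e : L →+* L') (y : L) : (Q.comap e).valuation y = 1 ↔ Q.valuation (e y) = 1 := by
  rw [le_antisymm_iff, le_antisymm_iff, valuation_comap_le_one_iff, ← not_lt (b := (1 : _)),
    valuation_comap_lt_one_iff, not_lt]

/-- `x` has a simple pole at `P` and is regular at all other points. -/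
structure IsPoleCoordinate (k : Type*) {L : Type*} [Field k] [Field L] [Algebra k L]
    (P : ValuationSubring L) (x : L) : Prop where
  one_lt : 1 < P.valuation x
  -- Simplicity of the pole: `x⁻¹` bounds the whole maximal ideal, with no discreteness assumed.
  mul_le_one : ∀ y, P.valuation y < 1 → P.valuation (y * x) ≤ 1
  regular : ∀ Q : ValuationSubring L, IsPoint k Q → Q ≠ P → x ∈ Q

namespace IsPoleCoordinate

variable {P : ValuationSubring L} {x : L}

theorem ne_zero (hx : IsPoleCoordinate k P x) : x ≠ 0 := by
  rintro rfl
  simpa using hx.one_lt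

theorem valuation_pos (hx : IsPoleCoordinate k P x) : 0 < P.valuation x :=
  zero_lt_one.trans hx.one_lt

theorem inv_lt_one (hx : IsPoleCoordinate k P x) : P.valuation x⁻¹ < 1 := by
  rw [map_inv₀]
  exact inv_lt_one_of_one_lt₀ hx.one_lt

/-- The Riemann–Roch space of `N` times `P`. The value of `y / x ^ N` at `P` is the leading
coefficient; subtracting the leading term lowers the pole order, and for `N = 0` no pole is left. -/
theorem exists_aeval_eq (hL : IsCurve k L) (hP : IsRationalPoint k P)
    (hx : IsPoleCoordinate k P x) (N : ℕ) {y : L} (hyP : P.valuation y ≤ P.valuation x ^ N)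
    (hy : ∀ Q : ValuationSubring L, IsPoint k Q → Q ≠ P → y ∈ Q) :
    ∃ p : k[X], p.natDegree ≤ N ∧ aeval x p = y := by
  induction N generalizing y with
  | zero =>
    rw [pow_zero] at hyP
    obtain ⟨a, rfl⟩ := hL.constants y (isAlgebraic_of_forall_mem fun Q hQ => by
      by_cases h : Q = P
      · exact h ▸ (P.valuation_le_one_iff y).1 hyP
      · exact hy Q hQ h)
    exact ⟨C a, by simp, by simp⟩
  | succ N ih =>
    have hx0 := hx.ne_zero
    have hv := hx.valuation_pos
    have h1 : y * (x⁻¹) ^ (N + 1) ∈ P := by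
      rw [← P.valuation_le_one_iff, map_mul, map_pow, map_inv₀, inv_pow]
      exact mul_inv_le_one_of_le₀ hyP (pow_pos hv _).le
    obtain ⟨a, ha⟩ := hP.2 _ h1
    rw [ValuationSubring.mem_nonunits_iff] at ha
    have h2 := hx.mul_le_one _ ha
    have h3 : (y * (x⁻¹) ^ (N + 1) - algebraMap k L a) * x =
        (y - algebraMap k L a * x ^ (N + 1)) * (x⁻¹) ^ N := by
      have h4 : x⁻¹ ^ (N + 1) * x = x⁻¹ ^ N := by
        rw [pow_succ, mul_assoc, inv_mul_cancel₀ hx0, mul_one]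
      have h5 : x ^ (N + 1) * x⁻¹ ^ N = x := by
        rw [pow_succ, mul_right_comm, ← mul_pow, mul_inv_cancel₀ hx0, one_pow, one_mul]
      linear_combination y * h4 + algebraMap k L a * h5
    rw [h3, map_mul, map_pow, map_inv₀, inv_pow, mul_inv_le_iff₀ (pow_pos hv _), one_mul] at h2
    obtain ⟨p, hp, hpy⟩ := ih h2 fun Q hQ hQP =>
      sub_mem (hy Q hQ hQP) (mul_mem (hQ.1 a) (pow_mem (hx.regular Q hQ hQP) _))
    refine ⟨p + C a * X ^ (N + 1), ?_, by simp [hpy]⟩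
    refine (natDegree_add_le _ _).trans (max_le (hp.trans N.le_succ) ?_)
    exact natDegree_C_mul_X_pow_le _ _

theorem exists_linear (hL : IsCurve k L) (hP : IsRationalPoint k P)
    (hx : IsPoleCoordinate k P x) {y : L} (hyP : P.valuation y ≤ P.valuation x)
    (hy : ∀ Q : ValuationSubring L, IsPoint k Q → Q ≠ P → y ∈ Q) :
    ∃ a b : k, y = algebraMap k L a * x + algebraMap k L b := by
  obtain ⟨p, hp, rfl⟩ := exists_aeval_eq hL hP hx 1 (by rwa [pow_one]) hy
  obtain ⟨a, b, rfl⟩ := exists_eq_X_add_C_of_natDegree_le_one hp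
  exact ⟨a, b, by simp⟩

theorem transcendental (hP : IsRationalPoint k P) (hL : IsCurve k L)
    (hx : IsPoleCoordinate k P x) : Transcendental k x := by
  intro h
  obtain ⟨a, rfl⟩ := hL.constants x h
  exact (hP.1.valuation_algebraMap_le a).not_gt hx.one_lt

end IsPoleCoordinate

/-- The transcendence degree is one, so any transcendental `x` is by itself a transcendence basis.
-/
theorem IsCurve.isAlgebraic_adjoin (hL : IsCurve k L) {x : L} (hx : Transcendental k x) :
    Algebra.IsAlgebraic (Algebra.adjoin k {x}) L := by
  obtain ⟨x₀, -, hfin⟩ := hL.exists_finite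
  have h0 : Algebra.IsAlgebraic (Algebra.adjoin k {x₀}) L := by
    have : Algebra.IsAlgebraic k⟮x₀⟯ L := inferInstance
    exact (IsFractionRing.comap_isAlgebraic_iff (A := Algebra.adjoin k {x₀}) (K := k⟮x₀⟯)
      (C := L)).2 this
  have h1 : Algebra.trdeg k L ≤ Cardinal.mk ({x₀} : Set L) :=
    Algebra.IsAlgebraic.trdeg_le_cardinalMk k {x₀}
  have h2 : AlgebraicIndependent k (fun _ : Unit => x) :=
    algebraicIndependent_unique_type_iff.2 hx
  have h3 := h2.isTranscendenceBasis_of_lift_trdeg_le_of_finite (by simpa using h1)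
  have h4 := h3.isAlgebraic
  rwa [Set.range_const] at h4

theorem mem_valuationSubring_of_isIntegral {Q : ValuationSubring L} {A : Subalgebra k L}
    (hA : A.toSubring ≤ Q.toSubring) {z : L} (hz : IsIntegral A z) : z ∈ Q := by
  obtain ⟨p, hp, hpz⟩ := hz
  have h : IsIntegral Q z := by
    refine ⟨p.map (Subring.inclusion hA), hp.map _, ?_⟩
    rw [eval₂_map]
    exact hpz
  obtain ⟨y, rfl⟩ := IsIntegrallyClosed.isIntegral_iff.1 h
  exact y.2

theorem adjoin_singleton_le {Q : ValuationSubring L} (hQ : ∀ a : k, algebraMap k L a ∈ Q) {x : L}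
    (hx : x ∈ Q) : (Algebra.adjoin k {x}).toSubring ≤ Q.toSubring := by
  intro z hz
  refine Algebra.adjoin_induction (p := fun z _ => z ∈ Q) ?_ hQ (fun _ _ _ _ => add_mem)
    (fun _ _ _ _ => mul_mem) hz
  rintro _ rfl
  exact hx

/-- The functions whose pole at `P` is dominated by a power of `x`. -/
def boundedBy (P : ValuationSubring L) {x : L} (hx : 1 < P.valuation x) : ValuationSubring L :=
  P.ofLE
    { carrier := {y | ∃ N : ℕ, P.valuation y ≤ P.valuation x ^ N}
      mul_mem' := by
        rintro a b ⟨M, hM⟩ ⟨N, hN⟩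
        exact ⟨M + N, by rw [map_mul, pow_add]; exact mul_le_mul' hM hN⟩
      one_mem' := ⟨0, by simp⟩
      add_mem' := by
        rintro a b ⟨M, hM⟩ ⟨N, hN⟩
        refine ⟨max M N, (P.valuation.map_add a b).trans (max_le ?_ ?_)⟩
        · exact hM.trans (pow_le_pow_right₀ hx.le (le_max_left _ _))
        · exact hN.trans (pow_le_pow_right₀ hx.le (le_max_right _ _))
      zero_mem' := ⟨0, by simp⟩
      neg_mem' := by
        rintro a ⟨M, hM⟩
        exact ⟨M, by rwa [Valuation.map_neg]⟩ }
    fun y hy => ⟨0, by simpa using (P.valuation_le_one_iff y).2 hy⟩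

theorem mem_boundedBy {P : ValuationSubring L} {x : L} (hx : 1 < P.valuation x) {y : L} :
    y ∈ boundedBy P hx ↔ ∃ N : ℕ, P.valuation y ≤ P.valuation x ^ N :=
  Iff.rfl

/-- Some nonzero multiple `q • y` with `q ∈ k[x]` is integral over `k[x]`. It has no pole off `P`,
so it is a polynomial in `x`. -/
theorem IsPoleCoordinate.adjoin_eq_top {P : ValuationSubring L} {x : L} (hL : IsCurve k L)
    (hP : IsRationalPoint k P) (hx : IsPoleCoordinate k P x) : k⟮x⟯ = ⊤ := by
  have halg := hL.isAlgebraic_adjoin (hx.transcendental hP hL)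
  rw [eq_top_iff]
  rintro y -
  obtain ⟨q, hq0, hq⟩ := (halg.isAlgebraic y).exists_integral_multiple
  -- `P` is not known to have rank one, so a bound by a power of `x` is not automatic. It holds
  -- because `boundedBy` is a valuation ring containing `k[x]`, hence is integrally closed.
  have hB : q • y ∈ boundedBy P hx.one_lt :=
    mem_valuationSubring_of_isIntegral (adjoin_singleton_le
      (fun a => (mem_boundedBy _).2 ⟨0, by simpa using hP.1.valuation_algebraMap_le a⟩)
      ((mem_boundedBy _).2 ⟨1, by simp⟩)) hq
  obtain ⟨N, hN⟩ := (mem_boundedBy _).1 hB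
  obtain ⟨p, -, hp⟩ := hx.exists_aeval_eq hL hP N hN fun Q hQ hQP =>
    mem_valuationSubring_of_isIntegral (adjoin_singleton_le hQ.1 (hx.regular Q hQ hQP)) hq
  have hle := algebra_adjoin_le_adjoin k {x}
  have hq1 : (q : L) ∈ k⟮x⟯ := hle q.2
  have hpx : aeval x p ∈ k⟮x⟯ := hle (aeval_mem_adjoin_singleton k x)
  have hq0' : (q : L) ≠ 0 := by simpa using hq0
  have : y = aeval x p / q := by
    rw [hp, eq_div_iff hq0', Subalgebra.smul_def, smul_eq_mul, mul_comm]
  rw [this]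
  exact div_mem hpx hq1

theorem IsPoint.valuation_aeval_sub_lt {Q : ValuationSubring L} (hQ : IsPoint k Q) {f : L}
    (hf : Q.valuation f < 1) (p : k[X]) :
    Q.valuation (aeval f p - algebraMap k L (p.coeff 0)) < 1 := by
  have h1 : Q.valuation (aeval f p.divX) ≤ 1 :=
    (Q.valuation_le_one_iff _).2 (adjoin_singleton_le hQ.1 ((Q.valuation_le_one_iff f).1 hf.le)
      (aeval_mem_adjoin_singleton k f))
  have h2 : aeval f p - algebraMap k L (p.coeff 0) = aeval f p.divX * f := by
    conv_lhs => rw [← divX_mul_X_add p]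
    simp
  rw [h2, map_mul]
  exact (mul_le_of_le_one_left' h1).trans_lt hf

theorem IsPoint.valuation_aeval_eq_one {Q : ValuationSubring L} (hQ : IsPoint k Q) {f : L}
    (hf : Q.valuation f < 1) {p : k[X]} (hp : p.coeff 0 ≠ 0) : Q.valuation (aeval f p) = 1 := by
  have h := hQ.valuation_algebraMap hp
  rw [← h]
  exact Valuation.map_eq_of_sub_lt _ (by rw [h]; exact hQ.valuation_aeval_sub_lt hf p)

/-- A nonzero element of `k(f)` is a power of `f` up to a factor which is a unit at all zeros
of `f`. -/
theorem exists_zpow_mul_unit {f : L} (hf : f ≠ 0) {y : L} (hy : y ∈ k⟮f⟯) (hy0 : y ≠ 0) :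
    ∃ (m : ℤ) (u : L), y = f ^ m * u ∧
      (∀ Q : ValuationSubring L, IsPoint k Q → Q.valuation f < 1 → Q.valuation u = 1) ∧
      ∃ c : k, ∀ Q : ValuationSubring L, IsPoint k Q → Q.valuation f < 1 →
        Q.valuation (u - algebraMap k L c) < 1 := by
  obtain ⟨r, s, rfl⟩ := (mem_adjoin_simple_iff k y).1 hy
  have key : ∀ p : k[X], aeval f p ≠ 0 → ∃ (m : ℕ) (q : k[X]), q.coeff 0 ≠ 0 ∧
      aeval f p = f ^ m * aeval f q := by
    intro p hp
    have hp0 : p ≠ 0 := by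
      rintro rfl
      simp at hp
    obtain ⟨q, hq, hdvd⟩ := exists_eq_pow_rootMultiplicity_mul_and_not_dvd p hp0 0
    rw [map_zero, sub_zero] at hq hdvd
    exact ⟨_, q, fun h => hdvd (X_dvd_iff.2 h), by conv_lhs => rw [hq]; simp⟩
  obtain ⟨m, q, hq, hr⟩ := key r (div_ne_zero_iff.1 hy0).1
  obtain ⟨m', q', hq', hs⟩ := key s (div_ne_zero_iff.1 hy0).2
  refine ⟨m - m', aeval f q / aeval f q', ?_, fun Q hQ hfQ => ?_,
    q.coeff 0 / q'.coeff 0, fun Q hQ hfQ => ?_⟩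
  · rw [hr, hs, zpow_sub₀ hf, mul_div_mul_comm, zpow_natCast, zpow_natCast]
  · rw [map_div₀, hQ.valuation_aeval_eq_one hfQ hq, hQ.valuation_aeval_eq_one hfQ hq', div_one]
  · have hB := hQ.valuation_aeval_eq_one hfQ hq'
    have hB0 : aeval f q' ≠ 0 := by
      intro h
      rw [h, map_zero] at hB
      exact zero_ne_one hB
    have hb0 : algebraMap k L (q'.coeff 0) ≠ 0 := by simpa using hq'
    have h1 := hQ.valuation_aeval_sub_lt hfQ q
    have h2 := hQ.valuation_aeval_sub_lt hfQ q'
    have h3 : aeval f q / aeval f q' - algebraMap k L (q.coeff 0 / q'.coeff 0) =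
        (aeval f q - algebraMap k L (q.coeff 0)) / aeval f q' -
          algebraMap k L (q.coeff 0 / q'.coeff 0) *
            ((aeval f q' - algebraMap k L (q'.coeff 0)) / aeval f q') := by
      rw [map_div₀]
      field_simp
      ring
    rw [h3]
    refine Q.valuation.map_sub_lt ?_ ?_
    · rwa [map_div₀, hB, div_one]
    · rw [map_mul, map_div₀ Q.valuation, hB, div_one]
      exact (mul_le_of_le_one_left' (hQ.valuation_algebraMap_le _)).trans_lt h2

/-- Writing `y = t ^ m * u`, regularity of `y` at any zero of `t` depends only on the sign of `m`.
-/
theorem IsPoint.eq_of_adjoin_eq_top {Q Q' : ValuationSubring L} (hQ : IsPoint k Q)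
    (hQ' : IsPoint k Q') {t : L} (ht0 : t ≠ 0) (ht : k⟮t⟯ = ⊤) (hQt : Q.valuation t < 1)
    (hQt' : Q'.valuation t < 1) : Q = Q' := by
  have key : ∀ R : ValuationSubring L, R.valuation t < 1 → ∀ m : ℤ,
      R.valuation t ^ m ≤ 1 ↔ 0 ≤ m := by
    intro R hR m
    exact zpow_le_one_iff_right_of_lt_one₀ (zero_lt_iff.2 (by simpa using ht0)) hR
  ext y
  by_cases hy : y = 0
  · simp [hy, zero_mem]
  obtain ⟨m, u, rfl, hu, -⟩ := exists_zpow_mul_unit ht0 (y := y) (ht ▸ IntermediateField.mem_top) hy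
  rw [← ValuationSubring.valuation_le_one_iff, ← ValuationSubring.valuation_le_one_iff, map_mul,
    map_mul, hu Q hQ hQt, hu Q' hQ' hQt', mul_one, mul_one, map_zpow₀, map_zpow₀, key Q hQt,
    key Q' hQt']

theorem IsPoint.isRationalPoint_of_adjoin_eq_top {Q : ValuationSubring L} (hQ : IsPoint k Q)
    {t : L} (ht0 : t ≠ 0) (ht : k⟮t⟯ = ⊤) (hQt : Q.valuation t < 1) : IsRationalPoint k Q := by
  refine ⟨hQ, fun y hy => ?_⟩
  rw [← ValuationSubring.valuation_le_one_iff] at hy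
  by_cases hy1 : Q.valuation y < 1
  · exact ⟨0, by rwa [map_zero, sub_zero, ValuationSubring.mem_nonunits_iff]⟩
  have hy2 : Q.valuation y = 1 := le_antisymm hy (not_lt.1 hy1)
  have hy0 : y ≠ 0 := by
    rintro rfl
    simp at hy2
  obtain ⟨m, u, rfl, hu, c, hc⟩ :=
    exists_zpow_mul_unit ht0 (y := y) (ht ▸ IntermediateField.mem_top) hy0
  rw [map_mul, hu Q hQ hQt, mul_one, map_zpow₀, zpow_eq_one_iff_right₀ zero_le hQt.ne] at hy2
  exact ⟨c, by rw [hy2, zpow_zero, one_mul, ValuationSubring.mem_nonunits_iff]; exact hc Q hQ hQt⟩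

theorem IsPoint.isPoleCoordinate_inv {Q : ValuationSubring L} (hQ : IsPoint k Q)
    {t : L} (ht0 : t ≠ 0) (ht : k⟮t⟯ = ⊤) (hQt : Q.valuation t < 1) :
    IsPoleCoordinate k Q t⁻¹ where
  one_lt := by
    rw [map_inv₀]
    exact (one_lt_inv₀ (zero_lt_iff.2 (by simpa using ht0))).2 hQt
  mul_le_one y hy := by
    by_cases hy0 : y = 0
    · simp [hy0]
    have hvt : 0 < Q.valuation t := zero_lt_iff.2 (by simpa using ht0)
    obtain ⟨m, u, rfl, hu, -⟩ :=
      exists_zpow_mul_unit ht0 (y := y) (ht ▸ IntermediateField.mem_top) hy0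
    rw [map_mul, hu Q hQ hQt, mul_one, map_zpow₀, zpow_lt_one_iff_right_of_lt_one₀ hvt hQt] at hy
    rw [map_mul, map_mul, hu Q hQ hQt, mul_one, map_inv₀, map_zpow₀, ← zpow_sub_one₀ hvt.ne',
      zpow_le_one_iff_right_of_lt_one₀ hvt hQt]
    omega
  regular R hR hRQ := by
    have h : ¬ R.valuation t < 1 := fun h => hRQ (hR.eq_of_adjoin_eq_top hQ ht0 ht h hQt)
    rw [← ValuationSubring.valuation_le_one_iff, map_inv₀]
    exact inv_le_one_of_one_le₀ (not_lt.1 h)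

/-- Each point of `S` excludes at most one `c`, because a nonzero difference of constants is a unit.
-/
theorem IsPoleCoordinate.exists_valuation_sub_eq_one [Infinite k] {P : ValuationSubring L} {x : L}
    (hx : IsPoleCoordinate k P x) {S : Set (ValuationSubring L)} (hS : S.Finite)
    (hSP : ∀ Q ∈ S, IsPoint k Q ∧ Q ≠ P) :
    ∃ c : k, ∀ Q ∈ S, Q.valuation (x - algebraMap k L c) = 1 := by
  have hfin : (⋃ Q ∈ S, {c : k | Q.valuation (x - algebraMap k L c) < 1}).Finite := by
    refine hS.biUnion fun Q hQ => Set.Subsingleton.finite fun c hc d hd => ?_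
    by_contra hcd
    have h1 := (hSP Q hQ).1.valuation_algebraMap (sub_ne_zero.2 hcd)
    have h2 := Q.valuation.map_sub_lt hd hc
    rw [sub_sub_sub_cancel_left, ← map_sub, h1] at h2
    exact lt_irrefl _ h2
  obtain ⟨c, hc⟩ := hfin.exists_notMem
  refine ⟨c, fun Q hQ => le_antisymm ?_ ?_⟩
  · exact (Q.valuation_le_one_iff _).2 (sub_mem (hx.regular Q (hSP Q hQ).1 (hSP Q hQ).2)
      ((hSP Q hQ).1.1 c))
  · rw [← not_lt]
    exact fun h => hc (Set.mem_biUnion hQ h)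

theorem IsPoleCoordinate.valuation_linear {P : ValuationSubring L} (hP : IsPoint k P) {x : L}
    (hx : IsPoleCoordinate k P x) {a : k} (ha : a ≠ 0) (b : k) :
    P.valuation (algebraMap k L a * x + algebraMap k L b) = P.valuation x := by
  have h : P.valuation (algebraMap k L a * x) = P.valuation x := by
    rw [map_mul, hP.valuation_algebraMap ha, one_mul]
  rw [Valuation.map_add_eq_of_lt_left, h]
  rw [h]
  exact (hP.valuation_algebraMap_le b).trans_lt hx.one_lt

theorem IsPoleCoordinate.linear {P : ValuationSubring L} (hP : IsPoint k P) {x : L}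
    (hx : IsPoleCoordinate k P x) {a : k} (ha : a ≠ 0) (b : k) :
    IsPoleCoordinate k P (algebraMap k L a * x + algebraMap k L b) where
  one_lt := by
    rw [hx.valuation_linear hP ha]
    exact hx.one_lt
  mul_le_one y hy := by
    rw [map_mul, hx.valuation_linear hP ha, ← map_mul]
    exact hx.mul_le_one y hy
  regular Q hQ hQP := add_mem (mul_mem (hQ.1 a) (hx.regular Q hQ hQP)) (hQ.1 b)

end Points

/-! ### From genus zero to a function with one simple pole -/

section Genus

variable {k L : Type*} [Field k] [Field L] [Algebra k L]

/-- In a valuation ring any element of `M` outside `M ^ 2` generates `M`. If there is none, `M ^ n =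
M` and `f` itself generates. -/
theorem HasOrder.exists_uniformizer {P : ValuationSubring L} {f : L} {n : ℕ} (hn : n ≠ 0)
    (hf : HasOrder P f n) :
    ∃ ϖ : L, P.valuation ϖ < 1 ∧ (∀ y, P.valuation y < 1 → P.valuation y ≤ P.valuation ϖ) ∧
      P.valuation f = P.valuation ϖ ^ n := by
  obtain ⟨hfP, hspan⟩ := hf
  set M := IsLocalRing.maximalIdeal P with hM
  have hprin : ∃ ϖ : P, M = Ideal.span {ϖ} := by
    by_cases hM2 : M ^ 2 = M
    · refine ⟨⟨f, hfP⟩, ?_⟩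
      rw [hspan]
      have : IsIdempotentElem M := by rwa [IsIdempotentElem, ← pow_two]
      exact (this.pow_eq hn).symm
    · obtain ⟨ϖ, hϖ, hϖ2⟩ := SetLike.exists_of_lt
        (lt_of_le_of_ne (Ideal.pow_le_self two_ne_zero) hM2)
      refine ⟨ϖ, le_antisymm (fun y hy => ?_) ((Ideal.span_singleton_le_iff_mem _).2 hϖ)⟩
      rw [Ideal.mem_span_singleton]
      by_contra hdvd
      obtain ⟨c, hc⟩ := (ValuationRing.dvd_total ϖ y).resolve_left hdvd
      have hcM : c ∈ M := by
        rw [hM, IsLocalRing.mem_maximalIdeal, mem_nonunits_iff]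
        intro hcu
        exact hdvd (by rw [hc]; exact (hcu.mul_right_dvd).2 dvd_rfl)
      exact hϖ2 (by rw [hc, pow_two]; exact Ideal.mul_mem_mul hy hcM)
  obtain ⟨ϖ, hϖ⟩ := hprin
  refine ⟨ϖ, ?_, fun y hy => ?_, ?_⟩
  · rw [← ValuationSubring.valuation_lt_one_iff, ← hM, hϖ]
    exact Ideal.mem_span_singleton_self ϖ
  · have hyP : y ∈ P := (P.valuation_le_one_iff y).1 hy.le
    have : (⟨y, hyP⟩ : P) ∈ M := (P.valuation_lt_one_iff _).2 hy
    rw [hϖ, Ideal.mem_span_singleton] at this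
    obtain ⟨c, hc⟩ := this
    have hc' : y = ϖ * c := congrArg Subtype.val hc
    rw [hc', map_mul]
    exact mul_le_of_le_one_right' (P.valuation_le_one c)
  · rw [hϖ, Ideal.span_singleton_pow, Ideal.span_singleton_eq_span_singleton] at hspan
    obtain ⟨u, hu⟩ := hspan
    have hu' : f * (u : P) = (ϖ : L) ^ n := congrArg Subtype.val hu
    rw [← map_pow, ← hu', map_mul, ValuationSubring.valuation_unit, mul_one]

/-- On a curve of genus `0` there is a function whose only pole is a simple pole at a given
point. -/
theorem exists_isPoleCoordinate (hgenus : genus k L = 0) {P : ValuationSubring L}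
    (hP : IsPoint k P) {f : L} (hf0 : f ≠ 0) {n : ℕ} (hn : n ≠ 0) (hf : HasOrder P f n) :
    ∃ x : L, IsPoleCoordinate k P x ∧ P.valuation f * P.valuation x ^ n = 1 := by
  classical
  obtain ⟨ϖ, hϖ1, hϖ, hfϖ⟩ := hf.exists_uniformizer hn
  have hϖ0 : ϖ ≠ 0 := by
    rintro rfl
    rw [map_zero, zero_pow hn, map_eq_zero] at hfϖ
    exact hf0 hfϖ
  have hvϖ : P.valuation ϖ ≠ 0 := by simpa using hϖ0
  have htop := Submodule.Quotient.subsingleton_iff.1 (rank_zero_iff.1 hgenus)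
  -- The polar part `ϖ⁻¹` at `P` alone. Genus zero writes it as an integral family plus a constant
  -- family `x`, so `x` has this polar part at `P` and no other pole.
  let r : Point k L → L := Pi.single ⟨P, hP⟩ ϖ⁻¹
  have hr : r ∈ repartitions k L := by
    refine (Set.finite_singleton (⟨P, hP⟩ : Point k L)).subset fun Q hQ => ?_
    by_contra hne
    refine hQ ?_
    simp only [r]
    rw [Pi.single_eq_of_ne hne]
    exact zero_mem _
  have hr' : (⟨r, hr⟩ : repartitions k L) ∈
      (integralRepartitions k L ⊔ principalRepartitions k L).submoduleOf (repartitions k L) := by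
    rw [htop]
    exact Submodule.mem_top
  obtain ⟨s, hs, p, ⟨x, rfl⟩, hsp⟩ := Submodule.mem_sup.1 (Submodule.mem_comap.1 hr')
  have hsp' : ∀ Q : Point k L, s Q + x = r Q := fun Q => congrFun hsp Q
  have hvx : P.valuation x = (P.valuation ϖ)⁻¹ := by
    have h1 : x = ϖ⁻¹ - s ⟨P, hP⟩ := by
      rw [eq_sub_iff_add_eq, add_comm, hsp']
      exact Pi.single_eq_same _ _
    have h2 : P.valuation (s ⟨P, hP⟩) < P.valuation ϖ⁻¹ := by
      refine lt_of_le_of_lt ((P.valuation_le_one_iff _).2 (hs ⟨P, hP⟩)) ?_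
      rw [map_inv₀]
      exact (one_lt_inv₀ (zero_lt_iff.2 hvϖ)).2 hϖ1
    rw [h1, Valuation.map_sub_eq_of_lt_left _ h2, map_inv₀]
  refine ⟨x, ⟨?_, fun y hy => ?_, fun Q hQ hQP => ?_⟩, ?_⟩
  · rw [hvx]
    exact (one_lt_inv₀ (zero_lt_iff.2 hvϖ)).2 hϖ1
  · rw [map_mul, hvx]
    exact mul_inv_le_one_of_le₀ (hϖ y hy) (zero_lt_iff.2 hvϖ).le
  · have h := hsp' ⟨Q, hQ⟩
    have h0 : r ⟨Q, hQ⟩ = 0 := Pi.single_eq_of_ne (fun h => hQP (congrArg Subtype.val h)) _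
    rw [h0, add_eq_zero_iff_neg_eq] at h
    rw [← h]
    exact neg_mem (hs ⟨Q, hQ⟩)
  · rw [hfϖ, hvx, inv_pow, mul_inv_cancel₀ (pow_ne_zero _ hvϖ)]

end Genus

/-! ### Transitivity of the Galois group on the zeros of `f` -/

section Galois

variable {k L : Type*} [Field k] [Field L] [Algebra k L]

theorem IsPoint.comap {L' : Type*} [Field L'] [Algebra k L'] {Q : ValuationSubring L'}
    (hQ : IsPoint k Q) (e : L ≃+* L')
    (he : ∀ a : k, ∃ b : k, e (algebraMap k L a) = algebraMap k L' b) :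
    IsPoint k (Q.comap (e : L →+* L')) := by
  refine ⟨fun a => ?_, fun h => hQ.2 ?_⟩
  · obtain ⟨b, hb⟩ := he a
    rw [ValuationSubring.mem_comap]
    change e (algebraMap k L a) ∈ Q
    rw [hb]
    exact hQ.1 b
  · ext y
    refine ⟨fun _ => ValuationSubring.mem_top _, fun _ => ?_⟩
    have h1 : e.symm y ∈ Q.comap (e : L →+* L') := by
      rw [h]
      exact ValuationSubring.mem_top _
    have h2 : e (e.symm y) ∈ Q := h1
    rwa [e.apply_symm_apply] at h2

theorem algebraMap_norm_ne_zero {E : Type*} [Field E] [Algebra E L] [FiniteDimensional E L] {z : L}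
    (hz : z ≠ 0) : algebraMap E L (Algebra.norm E z) ≠ 0 := by
  simpa using (Algebra.norm_ne_zero_iff (R := E)).2 hz

variable {f : L}

theorem comap_galois_isPoint {Q : ValuationSubring L} (hQ : IsPoint k Q)
    (g : L ≃ₐ[k⟮f⟯] L) : IsPoint k (Q.comap (g : L →+* L)) :=
  hQ.comap (g : L ≃+* L) fun a => ⟨a, by
    have := g.commutes (algebraMap k k⟮f⟯ a)
    rwa [← IsScalarTower.algebraMap_apply] at this⟩

variable [FiniteDimensional k⟮f⟯ L] [IsGalois k⟮f⟯ L]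

/-- The Galois group of `L / k(f)` permutes the zeros of `f` transitively. -/
theorem exists_comap_eq [Infinite k] (hf0 : f ≠ 0) {P Q : ValuationSubring L} (hP : IsPoint k P)
    (hQ : IsPoint k Q) (hPf : P.valuation f < 1) (hQf : Q.valuation f < 1) {x : L}
    (hx : IsPoleCoordinate k P x) :
    ∃ g : L ≃ₐ[k⟮f⟯] L, P.comap (g : L →+* L) = Q := by
  by_contra! hne
  -- If `Q` is not conjugate to `P`, some `z = x - c` is a unit at all conjugates of `Q` and at all
  -- conjugates of `P` except `P`. Its norm lies in `k(f)`, so it equals `f ^ m * u`. At `Q` this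
  -- forces `m = 0`; at `P` the factors have no zeros to cancel the pole of `z`.
  let S : Set (ValuationSubring L) :=
    {R | (∃ g : L ≃ₐ[k⟮f⟯] L, P.comap (g : L →+* L) = R) ∧ R ≠ P} ∪
      Set.range fun g : L ≃ₐ[k⟮f⟯] L => Q.comap (g : L →+* L)
  have hS : S.Finite := ((Set.finite_range fun g : L ≃ₐ[k⟮f⟯] L => P.comap (g : L →+* L)).subset
    fun R hR => hR.1).union (Set.finite_range _)
  obtain ⟨c, hc⟩ := hx.exists_valuation_sub_eq_one hS (by
    rintro R (⟨⟨g, rfl⟩, hR⟩ | ⟨g, rfl⟩)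
    · exact ⟨comap_galois_isPoint hP g, hR⟩
    · refine ⟨comap_galois_isPoint hQ g, fun h => hne g⁻¹ ?_⟩
      rw [← h, ValuationSubring.comap_comap]
      ext y
      rw [ValuationSubring.mem_comap]
      change g (g⁻¹ y) ∈ Q ↔ _
      rw [← AlgEquiv.mul_apply, mul_inv_cancel, AlgEquiv.one_apply])
  set z := x - algebraMap k L c with hz
  have hzP : P.valuation z = P.valuation x := by
    have := hx.valuation_linear hP one_ne_zero (-c)
    rwa [map_one, one_mul, map_neg, ← sub_eq_add_neg] at this
  have hz0 : z ≠ 0 := by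
    intro h
    rw [h, map_zero] at hzP
    exact hx.valuation_pos.ne hzP
  have hN : algebraMap k⟮f⟯ L (Algebra.norm k⟮f⟯ z) = ∏ g : L ≃ₐ[k⟮f⟯] L, g z :=
    Algebra.norm_eq_prod_automorphisms k⟮f⟯ z
  obtain ⟨m, u, hNu, hu, -⟩ := exists_zpow_mul_unit (k := k) hf0
    (Algebra.norm k⟮f⟯ z).2 (algebraMap_norm_ne_zero (E := k⟮f⟯) hz0)
  have hNu' : ∏ g : L ≃ₐ[k⟮f⟯] L, g z = f ^ m * u := hN.symm.trans hNu
  have hvQ : Q.valuation f ^ m = 1 := by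
    have h := congrArg Q.valuation hNu'
    rw [map_prod, map_mul, hu Q hQ hQf, mul_one, map_zpow₀, Finset.prod_eq_one] at h
    · exact h.symm
    · intro g _
      exact (valuation_comap_eq_one_iff Q (g : L →+* L) z).1 (hc _ (Or.inr ⟨g, rfl⟩))
  have hm : m = 0 := (zpow_eq_one_iff_right₀ zero_le hQf.ne).1 hvQ
  have hvP : ∏ g : L ≃ₐ[k⟮f⟯] L, P.valuation (g z) = 1 := by
    have h := congrArg P.valuation hNu'
    rwa [map_prod, map_mul, hu P hP hPf, mul_one, map_zpow₀, hm, zpow_zero] at h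
  have hge : ∀ g : L ≃ₐ[k⟮f⟯] L, 1 ≤ P.valuation (g z) := by
    intro g
    by_cases hg : P.comap (g : L →+* L) = P
    · rw [← not_lt]
      refine (valuation_comap_lt_one_iff P (g : L →+* L) z).not.1 ?_
      rw [hg, hzP, not_lt]
      exact hx.one_lt.le
    · exact ((valuation_comap_eq_one_iff P (g : L →+* L) z).1 (hc _ (Or.inl ⟨⟨g, rfl⟩, hg⟩))).ge
  have h1 := (Finset.prod_eq_one_iff_of_one_le' fun g _ => hge g).1 hvP 1 (Finset.mem_univ _)
  rw [AlgEquiv.one_apply, hzP] at h1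
  exact hx.one_lt.ne' h1

end Galois

/-! ### The stabilizer of `P` and its action on a coordinate -/

section Stabilizer

variable {k L : Type*} [Field k] [Field L] [Algebra k L] {P : ValuationSubring L} {x : L}

theorem comap_injective (e : L ≃+* L) {Q R : ValuationSubring L}
    (h : Q.comap (e : L →+* L) = R.comap (e : L →+* L)) : Q = R := by
  ext y
  have := ValuationSubring.ext_iff.1 h (e.symm y)
  rw [ValuationSubring.mem_comap, ValuationSubring.mem_comap] at this
  change e (e.symm y) ∈ Q ↔ e (e.symm y) ∈ R at this
  rwa [e.apply_symm_apply] at this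

/-- A semilinear automorphism of a curve fixing the point `P` acts on a coordinate with its only
pole at `P` by an affine transformation. -/
theorem IsPoleCoordinate.exists_apply_eq_linear (hL : IsCurve k L) (hP : IsRationalPoint k P)
    (hx : IsPoleCoordinate k P x) (e : L ≃+* L)
    (he : ∀ a : k, ∃ b : k, e (algebraMap k L a) = algebraMap k L b)
    (heP : P.comap (e : L →+* L) = P) :
    ∃ a b : k, a ≠ 0 ∧ e x = algebraMap k L a * x + algebraMap k L b := by
  have hlt : ∀ y, P.valuation y < 1 ↔ P.valuation (e y) < 1 := by
    intro y
    conv_lhs => rw [← heP, valuation_comap_lt_one_iff]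
    rfl
  have hle : ∀ y, P.valuation y ≤ 1 ↔ P.valuation (e y) ≤ 1 := by
    intro y
    conv_lhs => rw [← heP, valuation_comap_le_one_iff]
    rfl
  -- The pole of `x` is simple, so it is cancelled by `e.symm x⁻¹`, which vanishes at `P`; applying
  -- `e` to the product gives the bound.
  have h1 : P.valuation (e x) ≤ P.valuation x := by
    have h2 : P.valuation (e.symm x⁻¹) < 1 := by
      rw [hlt, e.apply_symm_apply]
      exact hx.inv_lt_one
    have h3 := (hle _).1 (hx.mul_le_one _ h2)
    rwa [map_mul, e.apply_symm_apply, map_mul, map_inv₀, inv_mul_le_iff₀ hx.valuation_pos,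
      mul_one] at h3
  obtain ⟨a, b, hab⟩ := hx.exists_linear hL hP h1 fun Q hQ hQP => by
    have h4 : Q.comap (e : L →+* L) ≠ P := fun h => hQP (comap_injective e (h.trans heP.symm))
    exact hx.regular _ (hQ.comap e he) h4
  refine ⟨a, b, ?_, hab⟩
  rintro rfl
  rw [map_zero, zero_mul, zero_add] at hab
  have h5 := (hle x).2 (by rw [hab]; exact hP.1.valuation_algebraMap_le b)
  exact h5.not_gt hx.one_lt

theorem IsPoleCoordinate.linear_injective (hP : IsRationalPoint k P) (hx : IsPoleCoordinate k P x)
    {a b a' b' : k} (h : algebraMap k L a * x + algebraMap k L b =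
      algebraMap k L a' * x + algebraMap k L b') : a = a' ∧ b = b' := by
  have ha : a = a' := by
    by_contra hne
    have h1 := hx.valuation_linear hP.1 (sub_ne_zero.2 hne) (b - b')
    have h2 : algebraMap k L (a - a') * x + algebraMap k L (b - b') = 0 := by
      rw [map_sub, map_sub]
      linear_combination h
    rw [h2, map_zero] at h1
    exact hx.valuation_pos.ne h1
  subst ha
  exact ⟨rfl, (algebraMap k L).injective (add_left_cancel h)⟩

theorem ringHom_ext_of_adjoin_eq_top {L' : Type*} [Field L'] {x : L} (hx : k⟮x⟯ = ⊤)
    {φ ψ : L →+* L'} (h : ∀ a : k, φ (algebraMap k L a) = ψ (algebraMap k L a))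
    (hφψ : φ x = ψ x) : φ = ψ := by
  ext y
  obtain ⟨r, s, rfl⟩ := (mem_adjoin_simple_iff k y).1 (hx ▸ IntermediateField.mem_top)
  have key : ∀ p : k[X], φ (aeval x p) = ψ (aeval x p) := by
    intro p
    induction p using Polynomial.induction_on' with
    | add p q hp hq => rw [map_add, map_add, map_add, hp, hq]
    | monomial n a => rw [aeval_monomial, map_mul, map_mul, map_pow, map_pow, h, hφψ]
  rw [map_div₀, map_div₀, key, key]

variable (k P) in
/-- The decomposition group of the point `P` in the Galois group of `L / k(f)`. -/
def decompositionGroup (f : L) : Subgroup (L ≃ₐ[k⟮f⟯] L) where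
  carrier := {g | ∀ y, y ∈ P ↔ g y ∈ P}
  mul_mem' ha hb y := (hb y).trans (ha _)
  one_mem' _ := Iff.rfl
  inv_mem' {g} hg y := by
    rw [hg (g⁻¹ y), ← AlgEquiv.mul_apply, mul_inv_cancel, AlgEquiv.one_apply]

theorem mem_decompositionGroup_iff {f : L} {g : L ≃ₐ[k⟮f⟯] L} :
    g ∈ decompositionGroup k P f ↔ P.comap (g : L →+* L) = P :=
  ⟨fun h => ValuationSubring.ext _ _ fun y => (h y).symm, fun h y => by
    conv_lhs => rw [← h]
    rfl⟩

theorem galois_algebraMap {f : L} (g : L ≃ₐ[k⟮f⟯] L) (a : k) :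
    g (algebraMap k L a) = algebraMap k L a := by
  have := g.commutes (algebraMap k k⟮f⟯ a)
  rwa [← IsScalarTower.algebraMap_apply] at this

variable {f : L} [FiniteDimensional k⟮f⟯ L]

/-- The group acts by `x ↦ a g * x + b g`. The twisted average of the `g x` is an eigenvector with
character `a`, and its leading coefficient, the group order, is nonzero in characteristic zero. The
character is injective because `y` generates `L`. -/
theorem IsPoleCoordinate.exists_eigenvector [CharZero k] (hL : IsCurve k L)
    (hP : IsRationalPoint k P) (hx : IsPoleCoordinate k P x) :
    ∃ y : L, IsPoleCoordinate k P y ∧ P.valuation y = P.valuation x ∧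
      ∃ χ : decompositionGroup k P f →* k, Function.Injective χ ∧
        ∀ g : decompositionGroup k P f, (g : L ≃ₐ[k⟮f⟯] L) y = algebraMap k L (χ g) * y := by
  classical
  have : Fintype (decompositionGroup k P f) := Fintype.ofFinite _
  have hlin : ∀ g : decompositionGroup k P f, ∃ a b : k, a ≠ 0 ∧
      (g : L ≃ₐ[k⟮f⟯] L) x = algebraMap k L a * x + algebraMap k L b := fun g =>
    hx.exists_apply_eq_linear hL hP ((g : L ≃ₐ[k⟮f⟯] L) : L ≃+* L)
      (fun a => ⟨a, galois_algebraMap _ a⟩) (mem_decompositionGroup_iff.1 g.2)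
  choose a b ha hab using hlin
  have hmul : ∀ g h, a (g * h) = a g * a h := by
    intro g h
    refine (hx.linear_injective hP (b := b (g * h)) (b' := a h * b g + b h) ?_).1
    rw [← hab, Subgroup.coe_mul, AlgEquiv.mul_apply, hab h, map_add, map_mul, galois_algebraMap,
      galois_algebraMap, hab g]
    simp only [map_mul, map_add]
    ring
  have hone : a 1 = 1 := by
    have := hmul 1 1
    rw [mul_one] at this
    exact (mul_eq_left₀ (ha 1)).1 this.symm
  let y := ∑ g : decompositionGroup k P f, algebraMap k L (a g)⁻¹ * (g : L ≃ₐ[k⟮f⟯] L) x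
  have hcard : (Fintype.card (decompositionGroup k P f) : k) ≠ 0 :=
    Nat.cast_ne_zero.2 Fintype.card_ne_zero
  have hy : y = algebraMap k L (Fintype.card (decompositionGroup k P f) : k) * x +
      algebraMap k L (∑ g, (a g)⁻¹ * b g) := by
    simp only [y, hab]
    rw [map_sum, map_natCast, ← nsmul_eq_mul, ← Finset.card_univ, ← Finset.sum_const,
      ← Finset.sum_add_distrib]
    refine Finset.sum_congr rfl fun g _ => ?_
    rw [mul_add, ← mul_assoc, ← map_mul, ← map_mul, inv_mul_cancel₀ (ha g), map_one, one_mul]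
  have hyx : IsPoleCoordinate k P y := by
    rw [hy]
    exact hx.linear hP.1 hcard _
  have hgy : ∀ g : decompositionGroup k P f, (g : L ≃ₐ[k⟮f⟯] L) y = algebraMap k L (a g) * y := by
    intro g
    simp only [y]
    rw [map_sum, Finset.mul_sum, ← Equiv.sum_comp (Equiv.mulLeft g)
      fun h => algebraMap k L (a g) * (algebraMap k L (a h)⁻¹ * (h : L ≃ₐ[k⟮f⟯] L) x)]
    refine Finset.sum_congr rfl fun h _ => ?_
    rw [map_mul, galois_algebraMap, Equiv.coe_mulLeft, ← mul_assoc (algebraMap k L (a g)), ← map_mul,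
      hmul, mul_inv, ← mul_assoc (a g), mul_inv_cancel₀ (ha g), one_mul, Subgroup.coe_mul,
      AlgEquiv.mul_apply]
  refine ⟨y, hyx, ?_, { toFun := a, map_one' := hone, map_mul' := hmul }, ?_, hgy⟩
  · rw [hy, hx.valuation_linear hP.1 hcard]
  · intro g h hgh
    have hgh' : a g = a h := hgh
    have := ringHom_ext_of_adjoin_eq_top (hyx.adjoin_eq_top hL hP)
      (φ := ((g : L ≃ₐ[k⟮f⟯] L) : L →+* L)) (ψ := ((h : L ≃ₐ[k⟮f⟯] L) : L →+* L))
      (fun a => (galois_algebraMap _ a).trans (galois_algebraMap _ a).symm)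
      ((hgy g).trans (hgh' ▸ (hgy h).symm))
    exact Subtype.ext (AlgEquiv.ext fun z => RingHom.congr_fun this z)

variable [IsGalois k⟮f⟯ L]

/-- The ramification index divides the order of the decomposition group. -/
theorem IsPoleCoordinate.dvd_card_decompositionGroup [CharZero k] (hL : IsCurve k L)
    (hP : IsRationalPoint k P) (hx : IsPoleCoordinate k P x) {n : ℕ} (hn : n ≠ 0)
    (hfx : P.valuation f * P.valuation x ^ n = 1) :
    n ∣ Nat.card (decompositionGroup k P f) := by
  classical
  have hv := hx.valuation_pos
  have hf : P.valuation f = (P.valuation x ^ n)⁻¹ := eq_inv_of_mul_eq_one_left hfx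
  have hPf : P.valuation f < 1 := by
    rw [hf]
    exact inv_lt_one_of_one_lt₀ (one_lt_pow₀ hx.one_lt hn)
  have hf0 : f ≠ 0 := by
    rintro rfl
    simp at hfx
  let S : Set (ValuationSubring L) :=
    {R | (∃ g : L ≃ₐ[k⟮f⟯] L, P.comap (g : L →+* L) = R) ∧ R ≠ P}
  have hS : S.Finite := (Set.finite_range fun g : L ≃ₐ[k⟮f⟯] L => P.comap (g : L →+* L)).subset
    fun R hR => hR.1
  obtain ⟨c, hc⟩ := hx.exists_valuation_sub_eq_one hS (by
    rintro R ⟨⟨g, rfl⟩, hR⟩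
    exact ⟨comap_galois_isPoint hP.1 g, hR⟩)
  obtain ⟨z, hz⟩ : ∃ z, z = x - algebraMap k L c := ⟨_, rfl⟩
  rw [← hz] at hc
  -- Stabilizer elements preserve the pole of `z` at `P`; the others make `z` a unit there. So the
  -- norm has a pole of order exactly the stabilizer's order, while the order of `f ^ m * u` at `P`
  -- is a multiple of `n`.
  have hgz : ∀ g : L ≃ₐ[k⟮f⟯] L, P.valuation (g z) =
      if g ∈ decompositionGroup k P f then P.valuation x else 1 := by
    intro g
    split_ifs with hg
    · obtain ⟨a, b, ha, hab⟩ := hx.exists_apply_eq_linear hL hP (g : L ≃+* L)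
        (fun a => ⟨a, galois_algebraMap _ a⟩) (mem_decompositionGroup_iff.1 hg)
      rw [← hx.valuation_linear hP.1 ha (b - c), hz, map_sub, galois_algebraMap]
      change P.valuation ((g : L ≃+* L) x - _) = _
      rw [hab, map_sub (algebraMap k L), add_sub_assoc]
    · exact (valuation_comap_eq_one_iff P (g : L →+* L) z).1
        (hc _ ⟨⟨g, rfl⟩, fun h => hg (mem_decompositionGroup_iff.2 h)⟩)
  have hz0 : z ≠ 0 := by
    intro h
    have := hgz 1
    rw [if_pos (one_mem _), h, map_zero, map_zero] at this
    exact hv.ne this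
  obtain ⟨m, u, hNu, hu, -⟩ := exists_zpow_mul_unit (k := k) hf0
    (Algebra.norm k⟮f⟯ z).2 (algebraMap_norm_ne_zero (E := k⟮f⟯) hz0)
  have hN : ∏ g : L ≃ₐ[k⟮f⟯] L, g z = f ^ m * u :=
    (Algebra.norm_eq_prod_automorphisms k⟮f⟯ z).symm.trans hNu
  have h := congrArg P.valuation hN
  rw [map_prod, map_mul, hu P hP.1 hPf, mul_one, map_zpow₀, Finset.prod_congr rfl fun g _ => hgz g,
    Finset.prod_ite, Finset.prod_const_one, mul_one, Finset.prod_const, hf] at h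
  have hcard : (Finset.univ.filter fun g => g ∈ decompositionGroup k P f).card =
      Nat.card (decompositionGroup k P f) := by
    rw [← Fintype.card_subtype, ← Nat.card_eq_fintype_card]
  rw [hcard, ← zpow_natCast, ← zpow_natCast, ← zpow_neg, ← zpow_mul,
    zpow_right_inj₀ hv hx.one_lt.ne'] at h
  rw [← Int.natCast_dvd_natCast, h]
  exact ⟨-m, by ring⟩

/-- The decomposition group of a point with ramification index `n` is cyclic of order `n`, and it
acts on a suitable coordinate through the `n`-th roots of unity. -/
theorem IsPoleCoordinate.exists_generator [CharZero k] (hL : IsCurve k L)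
    (hP : IsRationalPoint k P) (hx : IsPoleCoordinate k P x) {n : ℕ} (hn : n ≠ 0)
    (hfx : P.valuation f * P.valuation x ^ n = 1) :
    ∃ y : L, IsPoleCoordinate k P y ∧ ∃ ζ : k, IsPrimitiveRoot ζ n ∧
      ∃ g ∈ decompositionGroup k P f, g y = algebraMap k L ζ * y ∧
        ∀ h ∈ decompositionGroup k P f, h ∈ Subgroup.zpowers g := by
  obtain ⟨y, hy, hyx, χ, hχ, hχy⟩ := hx.exists_eigenvector (f := f) hL hP
  rw [← hyx] at hfx
  have hcyc : IsCyclic (decompositionGroup k P f) := isCyclic_of_injective_ringHom χ hχ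
  obtain ⟨g, hg⟩ := hcyc.exists_generator
  have hord : orderOf (χ g) = Nat.card (decompositionGroup k P f) := by
    rw [orderOf_injective χ hχ, orderOf_eq_card_of_forall_mem_zpowers hg]
  -- `u = f * y ^ n` is a unit at `P`. The automorphism `g` multiplies it by `χ g ^ n` but preserves
  -- its value `c` at `P`.
  have hpow : χ g ^ n = 1 := by
    by_contra hne
    set u := f * y ^ n with hu
    have hvu : P.valuation u = 1 := by rw [hu, map_mul, map_pow, hfx]
    obtain ⟨c, hc⟩ := hP.2 u ((P.valuation_le_one_iff u).1 hvu.le)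
    rw [ValuationSubring.mem_nonunits_iff] at hc
    have hgu : (g : L ≃ₐ[k⟮f⟯] L) u = algebraMap k L (χ g ^ n) * u := by
      have hgf : (g : L ≃ₐ[k⟮f⟯] L) f = f :=
        (g : L ≃ₐ[k⟮f⟯] L).commutes (AdjoinSimple.gen k f)
      rw [hu, map_mul, hgf, map_pow, hχy, map_pow]
      ring
    have hc' : P.valuation ((g : L ≃ₐ[k⟮f⟯] L) (u - algebraMap k L c)) < 1 := by
      rw [← mem_decompositionGroup_iff.1 g.2] at hc
      exact (valuation_comap_lt_one_iff P _ _).1 hc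
    rw [map_sub, galois_algebraMap, hgu] at hc'
    have h1 := P.valuation.map_sub_lt hc' hc
    have h2 : algebraMap k L (χ g ^ n) * u - algebraMap k L c - (u - algebraMap k L c) =
        algebraMap k L (χ g ^ n - 1) * u := by
      rw [map_sub, map_one]
      ring
    rw [h2, map_mul, hvu, hP.1.valuation_algebraMap (sub_ne_zero.2 hne), mul_one] at h1
    exact lt_irrefl _ h1
  have hcard : Nat.card (decompositionGroup k P f) = n :=
    Nat.dvd_antisymm (hord ▸ orderOf_dvd_of_pow_eq_one hpow)
      (hy.dvd_card_decompositionGroup hL hP hn hfx)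
  refine ⟨y, hy, χ g, hcard ▸ hord ▸ IsPrimitiveRoot.orderOf (χ g), g, g.2, hχy g, fun h hh => ?_⟩
  obtain ⟨m, hm⟩ := Subgroup.mem_zpowers_iff.1 (hg ⟨h, hh⟩)
  exact Subgroup.mem_zpowers_iff.2 ⟨m, by simpa using congrArg Subtype.val hm⟩

end Stabilizer

/-! ### The projective line: the point `t = 0`, Laurent coefficients, scalings -/

section ProjectiveLine

variable {k : Type*} [Field k]

theorem valuation_algebraMap_C_le_one (a : k) :
    (idealX k).valuation (RatFunc k) (algebraMap k (RatFunc k) a) ≤ 1 := by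
  rw [IsScalarTower.algebraMap_apply k k[X] (RatFunc k)]
  exact IsDedekindDomain.HeightOneSpectrum.valuation_le_one _ _

theorem valuation_X_lt_one : (idealX k).valuation (RatFunc k) RatFunc.X < 1 := by
  rw [valuation_X_eq_neg_one, ← WithZero.exp_zero, WithZero.exp_lt_exp]
  norm_num

theorem isPoint_pointInfty : IsPoint k (pointInfty k) := by
  refine ⟨fun a => valuation_algebraMap_C_le_one a, fun h => ?_⟩
  have h1 : (RatFunc.X : RatFunc k)⁻¹ ∈ pointInfty k := by
    rw [h]
    exact ValuationSubring.mem_top _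
  have h2 : (idealX k).valuation (RatFunc k) (RatFunc.X)⁻¹ ≤ 1 := h1
  rw [map_inv₀] at h2
  have h3 : 0 < (idealX k).valuation (RatFunc k) RatFunc.X :=
    zero_lt_iff.2 (by simp)
  exact ((one_lt_inv₀ h3).2 valuation_X_lt_one).not_ge h2

theorem pointInfty_valuation_X : (pointInfty k).valuation RatFunc.X < 1 :=
  (Valuation.isEquiv_valuation_valuationSubring _).lt_one_iff_lt_one.1 valuation_X_lt_one

theorem isRationalPoint_pointInfty : IsRationalPoint k (pointInfty k) :=
  isPoint_pointInfty.isRationalPoint_of_adjoin_eq_top RatFunc.X_ne_zero RatFunc.adjoin_X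
    pointInfty_valuation_X

theorem isCurve_ratFunc : IsCurve k (RatFunc k) where
  exists_finite := by
    refine ⟨RatFunc.X, RatFunc.transcendental_X, ?_⟩
    rw [RatFunc.adjoin_X]
    exact Module.Finite.of_surjective (Algebra.linearMap _ _) fun y => ⟨⟨y, trivial⟩, rfl⟩
  constants y hy := by
    by_contra h
    refine RatFunc.transcendental_of_ne_C y (fun ⟨c, hc⟩ => h ⟨c, ?_⟩) hy
    rw [hc, RatFunc.algebraMap_eq_C]

section Laurent

open scoped RatFunc

theorem coeffAt_eq_zero {f : RatFunc k} (hf : (pointInfty k).valuation f < 1) {m : ℤ}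
    (hm : m ≤ 0) : coeffAt f m = 0 := by
  have h := ((isPoint_pointInfty (k := k)).isPoleCoordinate_inv RatFunc.X_ne_zero RatFunc.adjoin_X
    pointInfty_valuation_X).mul_le_one f hf
  rw [ValuationSubring.valuation_le_one_iff] at h
  have h' : Valued.v (algebraMap (RatFunc k) (LaurentSeries k) (f * RatFunc.X⁻¹)) ≤
      (1 : WithZero (Multiplicative ℤ)) := by
    rw [LaurentSeries.valuation_coe_ratFunc]
    exact h
  obtain ⟨g, hg⟩ := (LaurentSeries.val_le_one_iff_eq_coe k _).1 h'
  have hfX : f = RatFunc.X * (f * RatFunc.X⁻¹) := by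
    rw [mul_comm, mul_assoc, inv_mul_cancel₀ RatFunc.X_ne_zero, mul_one]
  rw [coeffAt, hfX, map_mul, ← hg, RatFunc.coe_X, HahnSeries.coeff_single_mul, one_mul,
    PowerSeries.coeff_coe, if_pos (by omega)]

/-- The substitution `∑ c m X ^ m ↦ ∑ σ (c m) (a X) ^ m` on Laurent series, as a function. -/
noncomputable def laurentTwistFun (σ : k →+* k) (a : kˣ) (f : HahnSeries ℤ k) : HahnSeries ℤ k where
  coeff m := (a : k) ^ m * σ (f.coeff m)
  isPWO_support' := f.isPWO_support.mono fun m hm => by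
    rw [Function.mem_support] at hm
    rw [HahnSeries.mem_support]
    intro h
    exact hm (by rw [h, map_zero, mul_zero])

theorem laurentTwistFun_coeff (σ : k →+* k) (a : kˣ) (f : HahnSeries ℤ k) (m : ℤ) :
    (laurentTwistFun σ a f).coeff m = (a : k) ^ m * σ (f.coeff m) :=
  rfl

theorem laurentTwistFun_mul (σ : k →+* k) (a : kˣ) (f g : HahnSeries ℤ k) :
    laurentTwistFun σ a (f * g) = laurentTwistFun σ a f * laurentTwistFun σ a g := by
  ext m
  rw [laurentTwistFun_coeff, HahnSeries.coeff_mul, HahnSeries.coeff_mul, map_sum, Finset.mul_sum]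
  refine Finset.sum_congr ?_ fun ij hij => ?_
  · ext ij
    simp [laurentTwistFun_coeff, zpow_ne_zero]
  · rw [Finset.mem_antidiagonal] at hij
    rw [← hij.2.2, zpow_add₀ a.ne_zero, map_mul, laurentTwistFun_coeff, laurentTwistFun_coeff]
    ring

/-- The substitution `∑ c m X ^ m ↦ ∑ σ (c m) (a X) ^ m` on Laurent series. -/
noncomputable def laurentTwist (σ : k →+* k) (a : kˣ) : LaurentSeries k →+* LaurentSeries k where
  toFun := laurentTwistFun σ a
  map_one' := by
    ext m
    rw [laurentTwistFun_coeff, HahnSeries.coeff_one]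
    split_ifs with h
    · simp [h]
    · simp
  map_zero' := by
    ext m
    simp [laurentTwistFun_coeff]
  map_add' f g := by
    ext m
    simp [laurentTwistFun_coeff, mul_add]
  map_mul' := laurentTwistFun_mul σ a

theorem laurentTwist_coeff (σ : k →+* k) (a : kˣ) (f : LaurentSeries k) (m : ℤ) :
    (laurentTwist σ a f).coeff m = (a : k) ^ m * σ (f.coeff m) :=
  rfl

theorem coe_C_laurent (c : k) : algebraMap (RatFunc k) (LaurentSeries k)
    (algebraMap k (RatFunc k) c) = HahnSeries.C c := by
  rw [IsScalarTower.algebraMap_apply k k[X] (RatFunc k),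
    ← IsScalarTower.algebraMap_apply k[X] (RatFunc k) (LaurentSeries k)]
  simp

/-- Both routes to Laurent series are ring homomorphisms agreeing on constants and on `X`. The case
`σ = id` covers `scale`; general `σ` is needed for conjugates. -/
theorem coeffAt_apply {ψ : RatFunc k →+* RatFunc k} {σ : k →+* k} {a : kˣ}
    (hC : ∀ c : k, ψ (algebraMap k (RatFunc k) c) = algebraMap k (RatFunc k) (σ c))
    (hX : ψ RatFunc.X = algebraMap k (RatFunc k) a * RatFunc.X) (f : RatFunc k) (m : ℤ) :
    coeffAt (ψ f) m = (a : k) ^ m * σ (coeffAt f m) := by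
  have h : (algebraMap (RatFunc k) (LaurentSeries k)).comp ψ =
      (laurentTwist σ a).comp (algebraMap (RatFunc k) (LaurentSeries k)) := by
    refine ringHom_ext_of_adjoin_eq_top (k := k) RatFunc.adjoin_X (fun c => ?_) ?_
    · rw [RingHom.comp_apply, RingHom.comp_apply, hC, coe_C_laurent, coe_C_laurent]
      ext m
      rw [laurentTwist_coeff]
      by_cases hm : m = 0
      · subst hm
        simp
      · simp [hm]
    · rw [RingHom.comp_apply, RingHom.comp_apply, hX, map_mul, coe_C_laurent, RatFunc.coe_X]
      ext m
      rw [laurentTwist_coeff, HahnSeries.C_mul_eq_smul, HahnSeries.coeff_smul]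
      by_cases hm : m = 1
      · subst hm
        simp
      · simp [hm]
  have h2 := RingHom.congr_fun h f
  rw [RingHom.comp_apply, RingHom.comp_apply] at h2
  rw [coeffAt, h2, laurentTwist_coeff]
  rfl

theorem coeffAt_injective {f g : RatFunc k} (h : ∀ m, coeffAt f m = coeffAt g m) : f = g :=
  (algebraMap (RatFunc k) (LaurentSeries k)).injective (HahnSeries.ext (funext h))

end Laurent

theorem scale_X (α : kˣ) :
    scale α RatFunc.X = algebraMap k (RatFunc k) α * RatFunc.X := by
  let : Invertible (α : k) := α.invertible
  have h := IsFractionRing.fieldEquivOfAlgEquiv_algebraMap k (RatFunc k) (RatFunc k)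
    (algEquivCMulXAddC (α : k) 0) X
  rw [RatFunc.algebraMap_X] at h
  refine h.trans ?_
  simp [RatFunc.algebraMap_eq_C]

theorem coeffAt_scale (α : kˣ) (f : RatFunc k) (m : ℤ) :
    coeffAt (scale α f) m = (α : k) ^ m * coeffAt f m :=
  coeffAt_apply (ψ := (scale α : RatFunc k →+* RatFunc k)) (σ := RingHom.id k)
    (fun c => (scale α).commutes c) (scale_X α) f m

theorem algEquiv_ext_of_adjoin_eq_top {L L' : Type*} [Field L] [Algebra k L] [Field L']
    [Algebra k L'] {x : L} (hx : k⟮x⟯ = ⊤) {e e' : L ≃ₐ[k] L'} (h : e x = e' x) : e = e' := by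
  have := ringHom_ext_of_adjoin_eq_top hx (φ := (e : L →+* L')) (ψ := (e' : L →+* L'))
    (fun a => (e.commutes a).trans (e'.commutes a).symm) h
  exact AlgEquiv.ext fun y => RingHom.congr_fun this y

theorem scale_mul (α β : kˣ) : scale (α * β) = scale α * scale β := by
  refine algEquiv_ext_of_adjoin_eq_top RatFunc.adjoin_X ?_
  rw [AlgEquiv.mul_apply, scale_X, scale_X, map_mul, AlgEquiv.commutes, scale_X, Units.val_mul,
    map_mul]
  ring

/-- `scale` as a group homomorphism. -/
noncomputable def scaleHom (k : Type*) [Field k] : kˣ →* (RatFunc k ≃ₐ[k] RatFunc k) :=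
  MonoidHom.mk' scale scale_mul

theorem scaleHom_injective : Function.Injective (scaleHom k) := by
  intro α β h
  have h1 := DFunLike.congr_fun h RatFunc.X
  change scale α _ = scale β _ at h1
  rw [scale_X, scale_X] at h1
  exact Units.ext ((algebraMap k (RatFunc k)).injective (mul_right_cancel₀ RatFunc.X_ne_zero h1))

/-- `X` also vanishes at the pulled-back point, and a generator of the function field has only one
zero. -/
theorem mem_pointInfty_iff_of_X {e : RatFunc k ≃+* RatFunc k}
    (he : ∀ a : k, ∃ b : k, e (algebraMap k _ a) = algebraMap k _ b)
    {a : k} (heX : e RatFunc.X = algebraMap k _ a * RatFunc.X) (f : RatFunc k) :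
    f ∈ pointInfty k ↔ e f ∈ pointInfty k := by
  have h : (pointInfty k).comap (e : RatFunc k →+* RatFunc k) = pointInfty k := by
    refine (isPoint_pointInfty.comap e he).eq_of_adjoin_eq_top isPoint_pointInfty
      RatFunc.X_ne_zero RatFunc.adjoin_X ?_ pointInfty_valuation_X
    rw [valuation_comap_lt_one_iff]
    change (pointInfty k).valuation (e RatFunc.X) < 1
    rw [heX, map_mul]
    exact (mul_le_of_le_one_left' (isPoint_pointInfty.valuation_algebraMap_le a)).trans_lt
      pointInfty_valuation_X
  conv_lhs => rw [← h]
  rfl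

theorem mem_pointInfty_iff_scale (α : kˣ) (f : RatFunc k) :
    f ∈ pointInfty k ↔ scale α f ∈ pointInfty k :=
  mem_pointInfty_iff_of_X (e := (scale α : RatFunc k ≃+* RatFunc k))
    (fun a => ⟨a, (scale α).commutes a⟩) (scale_X α) f

end ProjectiveLine

/-! ### Existence of the model -/

section Model

variable {k L : Type*} [Field k] [Field L] [Algebra k L] {P : ValuationSubring L}

theorem exists_algEquiv_ratFunc {t : L} (ht : Transcendental k t) (htop : k⟮t⟯ = ⊤) :
    ∃ θ : L ≃ₐ[k] RatFunc k, θ t = RatFunc.X := by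
  let e : RatFunc k ≃ₐ[k] L :=
    (RatFunc.algEquivOfTranscendental t ht).trans ((equivOfEq htop).trans topEquiv)
  have he : e RatFunc.X = t := by
    simp only [e, AlgEquiv.trans_apply]
    exact RatFunc.algEquivOfTranscendental_X t ht
  exact ⟨e.symm, by rw [← he, e.symm_apply_apply]⟩

theorem adjoin_inv_eq_top {x : L} (hx : k⟮x⟯ = ⊤) : k⟮x⁻¹⟯ = ⊤ := by
  rw [eq_top_iff, ← hx, adjoin_simple_le_iff]
  have := inv_mem (mem_adjoin_simple_self k x⁻¹)
  rwa [inv_inv] at this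

/-- The Galois hypothesis only gives an algebraic extension; finiteness comes from `L` having one
generator. -/
theorem finiteDimensional_of_adjoin_eq_top {f x : L} [Algebra.IsAlgebraic k⟮f⟯ L]
    (hx : k⟮x⟯ = ⊤) : FiniteDimensional k⟮f⟯ L := by
  have h1 : FiniteDimensional k⟮f⟯ k⟮f⟯⟮x⟯ :=
    adjoin.finiteDimensional (Algebra.IsIntegral.isIntegral x)
  have h2 : k⟮f⟯⟮x⟯ = ⊤ := by
    rw [eq_top_iff]
    intro y _
    have h3 : k⟮x⟯ ≤ k⟮f⟯⟮x⟯.restrictScalars k :=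
      adjoin_simple_le_iff.2 (mem_adjoin_simple_self k⟮f⟯ x)
    exact h3 (hx ▸ IntermediateField.mem_top : y ∈ k⟮x⟯)
  rw [h2] at h1
  exact Module.Finite.equiv (topEquiv (F := k⟮f⟯) (E := L)).toLinearEquiv

variable (k P) in
theorem mem_markedAut_iff_autCongr (θ : L ≃ₐ[k] RatFunc k) (hθ : MapsPoint θ P (pointInfty k))
    (f : L) (e : L ≃ₐ[k] L) :
    AlgEquiv.autCongr θ e ∈ markedAut k (θ f) (pointInfty k) ↔ e ∈ markedAut k f P := by
  have h : ∀ y, AlgEquiv.autCongr θ e (θ y) = θ (e y) := fun y => by simp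
  constructor
  · rintro ⟨h1, h2⟩
    refine ⟨θ.injective ((h f).symm.trans h1), fun y => ?_⟩
    rw [hθ y, hθ (e y), ← h]
    exact h2 _
  · rintro ⟨h1, h2⟩
    refine ⟨(h f).trans (congrArg θ h1), fun y => ?_⟩
    obtain ⟨y, rfl⟩ := θ.surjective y
    rw [h, ← hθ, ← hθ]
    exact h2 y

theorem exists_galois_of_apply_eq {f : L} (e : L ≃ₐ[k] L) (he : e f = f) :
    ∃ g : L ≃ₐ[k⟮f⟯] L, ∀ y, g y = e y := by
  have hmem : e ∈ k⟮f⟯.fixingSubgroup := by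
    rw [IntermediateField.mem_fixingSubgroup_iff]
    have := (forall_mem_adjoin_smul_eq_self_iff (S := {f}) k e).2 (by simpa using he)
    exact this
  exact ⟨fixingSubgroupEquiv _ ⟨e, hmem⟩, fun y => rfl⟩

theorem exists_isModel [CharZero k] {f : L} {n : ℕ} (hmarked : IsMarkedMap k f P)
    (hgenus : genus k L = 0) (hgalois : IsGaloisMap k f) (hn : n ≠ 0) (hram : HasOrder P f n) :
    ∃ θ : L ≃ₐ[k] RatFunc k, IsModel f P n θ := by
  have hgal : IsGalois k⟮f⟯ L := hgalois
  obtain ⟨hL, hf, hP⟩ := hmarked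
  obtain ⟨x, hx, hfx⟩ := exists_isPoleCoordinate hgenus hP.1 (by rintro rfl; exact hf isAlgebraic_zero) hn hram
  have hfin : FiniteDimensional k⟮f⟯ L := finiteDimensional_of_adjoin_eq_top (hx.adjoin_eq_top hL hP)
  obtain ⟨y, hy, ζ, hζ, g, hgD, hgy, hgen⟩ := hx.exists_generator hL hP hn hfx
  have htop := adjoin_inv_eq_top (hy.adjoin_eq_top hL hP)
  have hζ0 : ζ ≠ 0 := hζ.ne_zero hn
  obtain ⟨θ, hθ⟩ := exists_algEquiv_ratFunc (k := k) (t := y⁻¹)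
    (fun h => hy.transcendental hP hL (IsAlgebraic.inv_iff.1 h)) htop
  have hθP : MapsPoint θ P (pointInfty k) := by
    have h1 : (pointInfty k).comap (θ : L →+* RatFunc k) = P := by
      refine (isPoint_pointInfty.comap (θ : L ≃+* RatFunc k)
        fun a => ⟨a, θ.commutes a⟩).eq_of_adjoin_eq_top hP.1 (inv_ne_zero hy.ne_zero) htop ?_
        hy.inv_lt_one
      rw [valuation_comap_lt_one_iff]
      change (pointInfty k).valuation (θ y⁻¹) < 1
      rw [hθ]
      exact pointInfty_valuation_X
    intro z
    conv_lhs => rw [← h1]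
    rfl
  -- The generator multiplies `y` by `ζ`, hence `t = y⁻¹` by `ζ⁻¹`.
  refine ⟨θ, hθP, (Units.mk0 ζ hζ0)⁻¹, ?_, ?_⟩
  · exact (IsPrimitiveRoot.coe_units_iff.1 (by simpa using hζ)).inv
  · have hg : AlgEquiv.autCongr θ (AlgEquiv.restrictScalarsHom k g) =
        scale (Units.mk0 ζ hζ0)⁻¹ := by
      refine algEquiv_ext_of_adjoin_eq_top RatFunc.adjoin_X ?_
      rw [scale_X, ← hθ]
      change θ (g (θ.symm (θ y⁻¹))) = _
      rw [θ.symm_apply_apply, map_inv₀, hgy, mul_inv, map_mul, ← map_inv₀ (algebraMap k L),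
        θ.commutes]
      simp
    ext e
    obtain ⟨e, rfl⟩ := (AlgEquiv.autCongr θ).surjective e
    rw [mem_markedAut_iff_autCongr k P θ hθP, ← hg, SetLike.mem_coe, Subgroup.mem_zpowers_iff]
    simp only [← map_zpow, EmbeddingLike.apply_eq_iff_eq]
    constructor
    · rintro ⟨h1, h2⟩
      obtain ⟨h, hh⟩ := exists_galois_of_apply_eq e h1
      obtain ⟨m, rfl⟩ := Subgroup.mem_zpowers_iff.1
        (hgen h fun y => by rw [hh]; exact h2 y)
      exact ⟨m, AlgEquiv.ext hh⟩
    · rintro ⟨m, rfl⟩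
      have hm := zpow_mem hgD m
      exact ⟨(g ^ m).commutes (AdjoinSimple.gen k f), hm⟩

end Model

/-! ### The exponents occurring in the expansion of `f` -/

section Expansion

variable {K L : Type*} [Field K] [Field L] [Algebra K L] {f : L} {P : ValuationSubring L} {n : ℕ}
  {θ : L ≃ₐ[K] RatFunc K}

theorem comap_eq_of_mapsPoint (hθ : MapsPoint θ P (pointInfty K)) :
    (pointInfty K).comap (θ : L →+* RatFunc K) = P :=
  ValuationSubring.ext _ _ fun y => (hθ y).symm

/-- Comparing coefficients in `f(ζ t) = f(t)` gives `ζ ^ m = 1`; positivity of `m` is the vanishing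
of `f` at `P`. -/
theorem coeffAt_ne_zero_imp (hf : P.valuation f < 1) (hθ : IsModel f P n θ) {m : ℤ}
    (hm : coeffAt (θ f) m ≠ 0) : ∃ i : ℕ, 1 ≤ i ∧ m = i * n := by
  obtain ⟨hθP, ζ, hζ, hmod⟩ := hθ
  have hpos : 0 < m := by
    by_contra h
    refine hm (coeffAt_eq_zero ?_ (not_lt.1 h))
    rw [← comap_eq_of_mapsPoint hθP] at hf
    exact (valuation_comap_lt_one_iff _ _ _).1 hf
  have h1 : scale ζ ∈ markedAut K (θ f) (pointInfty K) := by
    rw [hmod]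
    exact Subgroup.mem_zpowers _
  have h2 := coeffAt_scale ζ (θ f) m
  rw [show scale ζ (θ f) = θ f from h1.1] at h2
  have h3 : ζ ^ m = 1 := by
    refine Units.ext ?_
    rw [Units.val_zpow_eq_zpow_val, Units.val_one]
    exact (mul_eq_right₀ hm).1 h2.symm
  obtain ⟨i, rfl⟩ := (hζ.zpow_eq_one_iff_dvd m).1 h3
  have hn : (0 : ℤ) ≤ n := Int.natCast_nonneg n
  have hi : 0 < i := pos_of_mul_pos_right hpos hn
  exact ⟨i.toNat, by omega, by rw [Int.toNat_of_nonneg hi.le, mul_comm]⟩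

/-- If `d` generates this group, `f` is a series in `t ^ (n * d)` and is invariant under `t ↦ ξ t`
for `ξ` of order `n * d`. This is a marked automorphism, so `ξ` is a power of `ζ`, and `d = ±1`. -/
theorem closure_support_eq_top [CharZero K] [IsSepClosed K] (hn : n ≠ 0)
    (hf : P.valuation f < 1) (hf0 : f ≠ 0) (hθ : IsModel f P n θ) :
    AddSubgroup.closure ((fun i : ℕ => (i : ℤ)) '' {i : ℕ | 1 ≤ i ∧ coeffAt (θ f) (i * n) ≠ 0}) =
      ⊤ := by
  obtain ⟨d, hd⟩ := Int.subgroup_cyclic (AddSubgroup.closure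
    ((fun i : ℕ => (i : ℤ)) '' {i : ℕ | 1 ≤ i ∧ coeffAt (θ f) (i * n) ≠ 0}))
  have hdvd : ∀ i : ℕ, 1 ≤ i → coeffAt (θ f) (i * n) ≠ 0 → d.natAbs ∣ i := by
    intro i hi hc
    have h1 : (i : ℤ) ∈ AddSubgroup.closure
        ((fun i : ℕ => (i : ℤ)) '' {i : ℕ | 1 ≤ i ∧ coeffAt (θ f) (i * n) ≠ 0}) :=
      AddSubgroup.subset_closure ⟨i, ⟨hi, hc⟩, rfl⟩
    rw [hd, ← AddSubgroup.zmultiples_eq_closure, Int.mem_zmultiples_iff] at h1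
    rwa [← Int.natCast_dvd_natCast, Int.natAbs_dvd]
  obtain ⟨m, hm⟩ : ∃ m, coeffAt (θ f) m ≠ 0 := by
    by_contra! h
    refine hf0 (θ.injective ?_)
    rw [map_zero]
    exact coeffAt_injective fun m => by rw [h m, coeffAt, map_zero, HahnSeries.coeff_zero]
  have hd0 : d.natAbs ≠ 0 := by
    obtain ⟨i, hi, rfl⟩ := coeffAt_ne_zero_imp hf hθ hm
    intro h
    have := hdvd i hi hm
    rw [h, zero_dvd_iff] at this
    omega
  have : NeZero ((n * d.natAbs : ℕ) : K) := ⟨Nat.cast_ne_zero.2 (mul_ne_zero hn hd0)⟩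
  obtain ⟨ξ, hξ⟩ := HasEnoughRootsOfUnity.exists_primitiveRoot K (n * d.natAbs)
  obtain ⟨ξ, rfl⟩ := hξ.isUnit (mul_ne_zero hn hd0)
  have hξ' := IsPrimitiveRoot.coe_units_iff.1 hξ
  have h1 : scale ξ (θ f) = θ f := by
    refine coeffAt_injective fun m => ?_
    rw [coeffAt_scale]
    by_cases hm : coeffAt (θ f) m = 0
    · rw [hm, mul_zero]
    obtain ⟨i, hi, rfl⟩ := coeffAt_ne_zero_imp hf hθ hm
    obtain ⟨j, rfl⟩ := hdvd i hi hm
    have h2 : (ξ : K) ^ (((d.natAbs * j : ℕ) : ℤ) * n) = 1 := by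
      have h3 : ((d.natAbs * j : ℕ) : ℤ) * n = ((n * d.natAbs * j : ℕ) : ℤ) := by
        push_cast
        ring
      rw [h3, zpow_natCast, pow_mul, hξ.pow_eq_one, one_pow]
    rw [h2, one_mul]
  have h2 : scale ξ ∈ markedAut K (θ f) (pointInfty K) := ⟨h1, mem_pointInfty_iff_scale ξ⟩
  obtain ⟨-, ζ, hζ, hmod⟩ := hθ
  rw [hmod] at h2
  obtain ⟨j, hj⟩ := Subgroup.mem_zpowers_iff.1 h2
  have h3 : ζ ^ j = ξ := scaleHom_injective (by rw [map_zpow]; exact hj)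
  have h4 : ξ ^ n = 1 := by
    rw [← h3, ← zpow_natCast, zpow_comm, zpow_natCast, hζ.pow_eq_one, one_zpow]
  have h5 := (hξ'.pow_eq_one_iff_dvd n).1 h4
  have h6 : d.natAbs = 1 := by
    have : n * d.natAbs ∣ n * 1 := by rwa [mul_one]
    exact Nat.dvd_one.1 (Nat.dvd_of_mul_dvd_mul_left (Nat.pos_of_ne_zero hn) this)
  rw [hd, ← AddSubgroup.zmultiples_eq_closure, eq_top_iff]
  intro z _
  rw [Int.mem_zmultiples_iff, ← Int.natAbs_dvd, h6]
  exact one_dvd z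

/-- Only `1` has to be reached, and that involves finitely many generators. -/
theorem exists_finset_closure_eq_top {S : Set ℕ}
    (hS : AddSubgroup.closure ((fun i : ℕ => (i : ℤ)) '' S) = ⊤) :
    ∃ I : Finset ℕ, (I : Set ℕ) ⊆ S ∧
      AddSubgroup.closure ((fun i : ℕ => (i : ℤ)) '' (I : Set ℕ)) = ⊤ := by
  have h1 : (1 : ℤ) ∈ Submodule.span ℤ ((fun i : ℕ => (i : ℤ)) '' S) := by
    rw [← Submodule.mem_toAddSubgroup, Submodule.span_int_eq_addSubgroupClosure, hS]
    trivial
  obtain ⟨T, hT, h1T⟩ := Submodule.mem_span_finite_of_mem_span h1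
  obtain ⟨I, hI, rfl⟩ := Finset.subset_set_image_iff.1 hT
  refine ⟨I, hI, ?_⟩
  rw [Finset.coe_image, ← Submodule.mem_toAddSubgroup,
    Submodule.span_int_eq_addSubgroupClosure] at h1T
  rw [eq_top_iff]
  intro z _
  simpa using zsmul_mem h1T z

end Expansion

/-! ### Normalized representatives and the scalings reaching them -/

section Normalization

variable {K : Type*} [Field K] {I : Finset ℕ} {b : ℕ → ℤ}

theorem zpow_sum₀ {μ : K} (hμ : μ ≠ 0) (s : Finset ℕ) (e : ℕ → ℤ) :
    μ ^ ∑ i ∈ s, e i = ∏ i ∈ s, μ ^ e i := by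
  classical
  induction s using Finset.induction_on with
  | empty => simp
  | insert i s hi ih => rw [Finset.sum_insert hi, Finset.prod_insert hi, zpow_add₀ hμ, ih]

/-- By the Bézout relation the product has weight one; dividing by it therefore normalizes, and the
factor `μ` is determined. -/
theorem prod_weighted_zpow (hb : ∑ i ∈ I, b i * (i : ℤ) = 1) {μ : K} (hμ : μ ≠ 0) (c : ℕ → K) :
    ∏ i ∈ I, (μ ^ i * c i) ^ b i = μ * ∏ i ∈ I, c i ^ b i := by
  have h : ∏ i ∈ I, (μ ^ i) ^ b i = μ := by
    conv_rhs => rw [← zpow_one μ, ← hb]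
    rw [zpow_sum₀ hμ]
    refine Finset.prod_congr rfl fun i _ => ?_
    rw [← zpow_natCast, ← zpow_mul, mul_comm]
  simp only [mul_zpow]
  rw [Finset.prod_mul_distrib, h]

theorem eq_one_of_forall_pow_eq_one (hb : ∑ i ∈ I, b i * (i : ℤ) = 1) {η : K} (hη : η ≠ 0)
    (h : ∀ i ∈ I, η ^ i = 1) : η = 1 := by
  have h1 := prod_weighted_zpow hb hη fun _ => 1
  simp only [one_zpow, Finset.prod_const_one, mul_one] at h1
  rw [← h1]
  exact Finset.prod_eq_one fun i hi => by rw [h i hi, one_zpow]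

theorem exists_isNormalizedRepr (hb : ∑ i ∈ I, b i * (i : ℤ) = 1) {c : ℕ → K}
    (hc : ∀ i ∈ I, c i ≠ 0) : ∃ c₀ : ℕ → K, IsNormalizedRepr I b c c₀ := by
  have h : ∏ i ∈ I, c i ^ b i ≠ 0 := Finset.prod_ne_zero_iff.2 fun i hi => zpow_ne_zero _ (hc i hi)
  refine ⟨fun i => (∏ i ∈ I, c i ^ b i)⁻¹ ^ i * c i,
    ⟨Units.mk0 _ (inv_ne_zero h), fun i _ => rfl⟩, ?_⟩
  rw [prod_weighted_zpow hb (inv_ne_zero h), inv_mul_cancel₀ h]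

/-- `α` is an `n`-th root of the weighted scaling factor. -/
theorem IsNormalizedRepr.exists_scaling [CharZero K] [IsSepClosed K] {n : ℕ} (hn : n ≠ 0)
    {c c₀ : ℕ → K} (h : IsNormalizedRepr I b c c₀) :
    ∃ α : Kˣ, ∀ i ∈ I, c₀ i = (α : K) ^ (i * n) * c i := by
  obtain ⟨⟨μ, hμ⟩, -⟩ := h
  have : NeZero (n : K) := ⟨Nat.cast_ne_zero.2 hn⟩
  obtain ⟨α, hα⟩ := IsSepClosed.exists_pow_nat_eq (μ : K) n
  have hα0 : α ≠ 0 := by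
    rintro rfl
    rw [zero_pow hn] at hα
    exact μ.ne_zero hα.symm
  refine ⟨Units.mk0 α hα0, fun i hi => ?_⟩
  rw [hμ i hi, Units.val_mk0, mul_comm i n, pow_mul, hα]

/-- `(β / α) ^ n` acts trivially in every weight `i ∈ I`, so it is `1` by Bézout. -/
theorem scaling_iff (hb : ∑ i ∈ I, b i * (i : ℤ) = 1) {n : ℕ} {c c₀ : ℕ → K}
    (hc : ∀ i ∈ I, c i ≠ 0) {α β : Kˣ} (hα : ∀ i ∈ I, c₀ i = (α : K) ^ (i * n) * c i) :
    (∀ i ∈ I, c₀ i = (β : K) ^ (i * n) * c i) ↔ ∃ ξ : Kˣ, ξ ^ n = 1 ∧ β = ξ * α := by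
  constructor
  · intro hβ
    refine ⟨β * α⁻¹, ?_, by rw [inv_mul_cancel_right]⟩
    refine Units.ext (eq_one_of_forall_pow_eq_one hb (Units.ne_zero _) fun i hi => ?_)
    have h1 : (β : K) ^ (i * n) = (α : K) ^ (i * n) :=
      mul_right_cancel₀ (hc i hi) ((hβ i hi).symm.trans (hα i hi))
    have h2 : β ^ (i * n) = α ^ (i * n) := Units.ext (by push_cast; exact h1)
    have h3 : ((β * α⁻¹) ^ n) ^ i = 1 := by
      rw [← pow_mul, mul_comm n i, mul_pow, h2, ← mul_pow, mul_inv_cancel, one_pow]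
    have h4 := congrArg Units.val h3
    rwa [Units.val_pow_eq_pow_val, Units.val_one] at h4
  · rintro ⟨ξ, hξ, rfl⟩ i hi
    have h : (ξ : K) ^ n = 1 := by
      have := congrArg Units.val hξ
      rwa [Units.val_pow_eq_pow_val, Units.val_one] at this
    rw [hα i hi, Units.val_mul, mul_pow, mul_comm i n, pow_mul (ξ : K), h, one_pow, one_mul]

end Normalization

/-! ### Semilinear automorphisms coming from isomorphic conjugates -/

section Conjugation

variable {k : Type*} [Field k]

/-- A priori `ψ` is affine in `X⁻¹`, with constant term `b`. It normalizes the group generated by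
`scale ζ`, whose fixed points are only `0` and `∞` since `ζ ≠ 1`; this kills `b`. -/
theorem exists_apply_X_eq {g : RatFunc k} {n : ℕ} (hn : 2 ≤ n) {ζ : kˣ} (hζ : IsPrimitiveRoot ζ n)
    (hmod : markedAut k g (pointInfty k) = (Subgroup.zpowers (scale ζ) : Set _))
    (ψ : RatFunc k ≃+* RatFunc k) (σ : k ≃+* k)
    (hψ : ∀ a : k, ψ (algebraMap k _ a) = algebraMap k _ (σ a)) (hψg : ψ g = g)
    (hψP : ∀ y, y ∈ pointInfty k ↔ ψ y ∈ pointInfty k) :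
    ∃ a : kˣ, ψ RatFunc.X = algebraMap k _ (a : k) * RatFunc.X := by
  have hx := (isPoint_pointInfty (k := k)).isPoleCoordinate_inv RatFunc.X_ne_zero RatFunc.adjoin_X
    pointInfty_valuation_X
  obtain ⟨a, b, ha, hab⟩ := hx.exists_apply_eq_linear isCurve_ratFunc isRationalPoint_pointInfty ψ
    (fun a => ⟨σ a, hψ a⟩) (ValuationSubring.ext _ _ fun y => (hψP y).symm)
  have hψsymm : ∀ a : k, ψ.symm (algebraMap k _ a) = algebraMap k _ (σ.symm a) := by
    intro a
    rw [RingEquiv.symm_apply_eq, hψ, σ.apply_symm_apply]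
  have hscale : scale ζ ∈ markedAut k g (pointInfty k) := by
    rw [hmod]
    exact Subgroup.mem_zpowers _
  let γ : RatFunc k ≃ₐ[k] RatFunc k :=
    AlgEquiv.ofRingEquiv (f := (ψ.symm.trans (scale ζ : RatFunc k ≃+* RatFunc k)).trans ψ)
      fun a => by
        change ψ (scale ζ (ψ.symm (algebraMap k _ a))) = _
        rw [hψsymm, AlgEquiv.commutes, hψ, σ.apply_symm_apply]
  have hγ : ∀ y, γ (ψ y) = ψ (scale ζ y) := by
    intro y
    change ψ (scale ζ (ψ.symm (ψ y))) = _
    rw [ψ.symm_apply_apply]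
  have hγmem : γ ∈ markedAut k g (pointInfty k) := by
    refine ⟨?_, fun y => ?_⟩
    · have := hγ g
      rw [hψg, show scale ζ g = g from hscale.1, hψg] at this
      exact this
    · obtain ⟨y, rfl⟩ := ψ.surjective y
      rw [hγ, ← hψP, ← hψP]
      exact hscale.2 y
  rw [hmod] at hγmem
  obtain ⟨j, hj⟩ := Subgroup.mem_zpowers_iff.1 hγmem
  have hj' : γ = scale (ζ ^ j) := by
    rw [← hj]
    exact (map_zpow (scaleHom k) ζ j).symm
  have hscale_inv : ∀ α : kˣ, scale α (RatFunc.X)⁻¹ =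
      algebraMap k _ ((α : k)⁻¹) * (RatFunc.X)⁻¹ := by
    intro α
    rw [map_inv₀, scale_X, mul_inv, map_inv₀]
  have h1 := hγ (RatFunc.X)⁻¹
  rw [hab, hj', hscale_inv, map_mul, map_add, map_mul, hψ, hab, AlgEquiv.commutes,
    AlgEquiv.commutes, hscale_inv, mul_add, ← mul_assoc, ← mul_assoc, ← map_mul, ← map_mul,
    ← map_mul] at h1
  -- Constant terms give `b = σ (ζ⁻¹) * b`.
  have h2 := (hx.linear_injective isRationalPoint_pointInfty h1).2
  have hb : b = 0 := by
    by_contra hb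
    have h3 : σ ((ζ : k)⁻¹) = 1 := (mul_eq_right₀ hb).1 h2.symm
    rw [map_eq_one_iff σ σ.injective, inv_eq_one, Units.val_eq_one] at h3
    have h4 := hζ.unique (h3 ▸ IsPrimitiveRoot.one)
    omega
  rw [hb, map_zero, add_zero, map_inv₀] at hab
  refine ⟨(Units.mk0 a ha)⁻¹, ?_⟩
  rw [← inv_inv (ψ RatFunc.X), hab, mul_inv, inv_inv, Units.val_inv_eq_inv_val, Units.val_mk0,
    map_inv₀]

variable {F K L : Type*} [Field F] [Field K] [Algebra F K] [Field L] [Algebra K L]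

theorem IsConjIso.exists_ringEquiv {σ : K ≃ₐ[F] K} {f : L} (h : IsConjIso σ f) :
    ∃ ε : L ≃+* L, (∀ a : K, ε (algebraMap K L a) = algebraMap K L (σ a)) ∧ ε f = f := by
  obtain ⟨e, he⟩ := h
  refine ⟨(toConj σ).trans (e : Conj σ L ≃+* L), fun a => ?_, he⟩
  have h1 : algebraMap K (Conj σ L) (σ a) = toConj σ (algebraMap K L a) := by
    change toConj σ (algebraMap K L (σ.symm (σ a))) = _
    rw [σ.symm_apply_apply]
  change e (toConj σ (algebraMap K L a)) = _
  rw [← h1, e.commutes]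

theorem IsConjIso.exists_coeffAt_eq [CharZero K] {σ : K ≃ₐ[F] K} {f : L} {P : ValuationSubring L}
    {n : ℕ} (hn : 2 ≤ n) (hP : IsPoint K P) (hf0 : f ≠ 0) (hf : P.valuation f < 1)
    (hgalois : IsGaloisMap K f) {θ : L ≃ₐ[K] RatFunc K} (hθ : IsModel f P n θ)
    (h : IsConjIso σ f) :
    ∃ a : Kˣ, ∀ m, coeffAt (θ f) m = (a : K) ^ m * σ (coeffAt (θ f) m) := by
  have hgal : IsGalois K⟮f⟯ L := hgalois
  obtain ⟨hθP, ζ, hζ, hmod⟩ := hθ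
  obtain ⟨ε, hε, hεf⟩ := h.exists_ringEquiv
  obtain ⟨t, ht⟩ : ∃ t, θ t = RatFunc.X := θ.surjective _
  have ht0 : t ≠ 0 := by
    rintro rfl
    rw [map_zero] at ht
    exact RatFunc.X_ne_zero ht.symm
  have htop : K⟮t⟯ = ⊤ := by
    have h1 : K⟮t⟯.map (θ : L →ₐ[K] RatFunc K) = ⊤ := by
      rw [adjoin_map, Set.image_singleton]
      change K⟮θ t⟯ = ⊤
      rw [ht, RatFunc.adjoin_X]
    rw [eq_top_iff]
    intro y _
    have h2 : θ y ∈ K⟮t⟯.map (θ : L →ₐ[K] RatFunc K) := h1 ▸ IntermediateField.mem_top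
    obtain ⟨z, hz, hzy⟩ := h2
    exact θ.injective hzy ▸ hz
  have hPt : P.valuation t < 1 := by
    rw [← comap_eq_of_mapsPoint hθP, valuation_comap_lt_one_iff]
    change (pointInfty K).valuation (θ t) < 1
    rw [ht]
    exact pointInfty_valuation_X
  have hx := hP.isPoleCoordinate_inv ht0 htop hPt
  have hfin : FiniteDimensional K⟮f⟯ L := finiteDimensional_of_adjoin_eq_top htop
  -- `ε` may move `P` to another zero of `f`; a Galois element `g` brings it back, without changing
  -- `f` or the constants.
  obtain ⟨g, hg⟩ := exists_comap_eq hf0 hP (hP.comap ε fun a => ⟨σ a, hε a⟩) hf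
    (by rw [valuation_comap_lt_one_iff]; exact hεf.symm ▸ hf) hx
  have hg' : ∀ y, g y ∈ P ↔ ε y ∈ P := fun y => ValuationSubring.ext_iff.1 hg y
  let ψ : RatFunc K ≃+* RatFunc K :=
    (((θ.symm : RatFunc K ≃+* L).trans (g.symm : L ≃+* L)).trans ε).trans
      (θ : L ≃+* RatFunc K)
  have hψ : ∀ y, ψ y = θ (ε (g.symm (θ.symm y))) := fun y => rfl
  have hψC : ∀ a : K, ψ (algebraMap K _ a) = algebraMap K _ (σ a) := by
    intro a
    rw [hψ, AlgEquiv.commutes, galois_algebraMap, hε, AlgEquiv.commutes]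
  have hψf : ψ (θ f) = θ f := by
    have : g.symm f = f := g.symm.commutes (AdjoinSimple.gen K f)
    rw [hψ, θ.symm_apply_apply, this, hεf]
  obtain ⟨a, ha⟩ := exists_apply_X_eq hn hζ hmod ψ (σ : K ≃+* K) hψC hψf fun y => by
    rw [hψ, ← hθP, ← hg', g.apply_symm_apply, hθP, θ.apply_symm_apply]
  refine ⟨a, fun m => ?_⟩
  have := coeffAt_apply (ψ := (ψ : RatFunc K →+* RatFunc K)) (σ := (σ : K →+* K)) hψC ha (θ f) m
  rw [show (ψ : RatFunc K →+* RatFunc K) (θ f) = θ f from hψf] at this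
  exact this

/-- If the conjugate of `f` by `σ` is isomorphic to `f`, then `σ` fixes all coefficients of the
normalized expansion of `f`. -/
theorem IsConjIso.apply_coeffAt_scale_eq [CharZero K] {σ : K ≃ₐ[F] K} {f : L}
    {P : ValuationSubring L} {n : ℕ} (hn : 2 ≤ n) (hP : IsPoint K P) (hf0 : f ≠ 0)
    (hf : P.valuation f < 1) (hgalois : IsGaloisMap K f) {θ : L ≃ₐ[K] RatFunc K}
    (hθ : IsModel f P n θ) (h : IsConjIso σ f) {I : Finset ℕ} {b : ℕ → ℤ}
    (hb : ∑ i ∈ I, b i * (i : ℤ) = 1) {α : Kˣ}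
    (hα : ∏ i ∈ I, coeffAt (scale α (θ f)) (i * n) ^ b i = 1) (m : ℤ) :
    σ (coeffAt (scale α (θ f)) m) = coeffAt (scale α (θ f)) m := by
  obtain ⟨a, ha⟩ := h.exists_coeffAt_eq hn hP hf0 hf hgalois hθ
  have hσα : σ (α : K) ≠ 0 := by simp
  -- From `c m = a ^ m * σ (c m)`, the coefficients `α ^ m * c m` are multiplied by `(σ α / (a * α))
  -- ^ m` under `σ`.
  set η : K := σ α * (a * α : K)⁻¹ with hη
  have hη0 : η ≠ 0 := mul_ne_zero hσα (inv_ne_zero (by simp))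
  have key : ∀ m, σ (coeffAt (scale α (θ f)) m) = η ^ m * coeffAt (scale α (θ f)) m := by
    intro m
    have h1 : (a : K) ^ m ≠ 0 := zpow_ne_zero _ a.ne_zero
    have h2 : (α : K) ^ m ≠ 0 := zpow_ne_zero _ α.ne_zero
    obtain ⟨d, hd⟩ : ∃ d, d = σ (coeffAt (θ f) m) := ⟨_, rfl⟩
    rw [coeffAt_scale, map_mul, map_zpow₀, ← hd, ha m, ← hd, hη, mul_zpow, inv_zpow, mul_zpow]
    field_simp
  -- `σ` multiplies the Bézout product by `η ^ n`, yet that product is `1`.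
  have hηn : η ^ n = 1 := by
    have h1 := prod_weighted_zpow hb (pow_ne_zero n hη0) fun i => coeffAt (scale α (θ f)) (i * n)
    rw [hα, mul_one] at h1
    rw [← h1, ← map_one σ, ← hα, map_prod]
    refine Finset.prod_congr rfl fun i _ => ?_
    rw [map_zpow₀, key, ← pow_mul, mul_comm n i, ← zpow_natCast, Nat.cast_mul]
  rw [key]
  by_cases hm : coeffAt (θ f) m = 0
  · rw [coeffAt_scale, hm, mul_zero, mul_zero]
  obtain ⟨i, -, rfl⟩ := coeffAt_ne_zero_imp hf hθ hm
  rw [← Nat.cast_mul, zpow_natCast, mul_comm i n, pow_mul, hηn, one_pow, one_mul]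

end Conjugation

/-! ### Descent of rational functions and of the marked line -/

section Descent

/-- The map on rational functions induced by a homomorphism on coefficients. -/
noncomputable def mapCoeffs {k k' : Type*} [Field k] [Field k'] (φ : k →+* k') :
    RatFunc k →+* RatFunc k' :=
  RatFunc.mapRingHom (mapRingHom φ) (nonZeroDivisors_le_comap_nonZeroDivisors_of_injective _
    (map_injective _ φ.injective))

section

variable {k k' : Type*} [Field k] [Field k'] (φ : k →+* k')

theorem mapCoeffs_algebraMap (p : k[X]) :
    mapCoeffs φ (algebraMap k[X] (RatFunc k) p) = algebraMap k'[X] (RatFunc k') (p.map φ) := by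
  have h := RatFunc.map_apply_div (mapRingHom φ) (nonZeroDivisors_le_comap_nonZeroDivisors_of_injective _
    (map_injective _ φ.injective)) p 1
  rw [map_one, map_one, map_one, div_one, div_one] at h
  exact h

theorem mapCoeffs_C (a : k) :
    mapCoeffs φ (algebraMap k (RatFunc k) a) = algebraMap k' (RatFunc k') (φ a) := by
  rw [RatFunc.algebraMap_eq_C, RatFunc.algebraMap_eq_C, ← RatFunc.algebraMap_C, mapCoeffs_algebraMap,
    map_C, RatFunc.algebraMap_C]

theorem mapCoeffs_X : mapCoeffs φ RatFunc.X = RatFunc.X := by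
  rw [← RatFunc.algebraMap_X, mapCoeffs_algebraMap, map_X, RatFunc.algebraMap_X]

theorem mapCoeffs_eq_div (f : RatFunc k) : mapCoeffs φ f =
    algebraMap k'[X] (RatFunc k') (f.num.map φ) / algebraMap k'[X] (RatFunc k') (f.denom.map φ) := by
  conv_lhs => rw [← RatFunc.num_div_denom f]
  rw [map_div₀, mapCoeffs_algebraMap, mapCoeffs_algebraMap]

end

/-- Lowest terms with monic denominator are unique. This transfers invariance from the power series
to the polynomials defining `f`. -/
theorem num_map_denom_map_of_mapCoeffs_eq {k : Type*} [Field k] {σ : k →+* k} {f : RatFunc k}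
    (h : mapCoeffs σ f = f) : f.num.map σ = f.num ∧ f.denom.map σ = f.denom := by
  have hmonic := RatFunc.monic_denom f
  have hmonic' : (f.denom.map σ).Monic := hmonic.map σ
  have hcop := RatFunc.isCoprime_num_denom f
  have hcop' : IsCoprime (f.num.map σ) (f.denom.map σ) := hcop.map (mapRingHom σ)
  have hmul : f.num.map σ * f.denom = f.num * f.denom.map σ := by
    refine RatFunc.algebraMap_injective k ?_
    rw [map_mul, map_mul, ← div_eq_div_iff, ← mapCoeffs_eq_div, h, RatFunc.num_div_denom]
    · exact RatFunc.algebraMap_ne_zero hmonic'.ne_zero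
    · exact RatFunc.algebraMap_ne_zero hmonic.ne_zero
  have hdenom : f.denom.map σ = f.denom :=
    eq_of_monic_of_associated hmonic' hmonic (associated_of_dvd_dvd
      (hcop'.symm.dvd_of_dvd_mul_left ⟨f.num, by rw [hmul, mul_comm]⟩)
      (hcop.symm.dvd_of_dvd_mul_left ⟨f.num.map σ, by rw [← hmul, mul_comm]⟩))
  rw [hdenom] at hmul
  exact ⟨mul_right_cancel₀ hmonic.ne_zero hmul, hdenom⟩

variable {F K L : Type*} [Field F] [Field K] [Algebra F K] [Field L] [Algebra K L]

theorem exists_extendScalars_eq {g : RatFunc K}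
    (hnum : ∀ m, g.num.coeff m ∈ Set.range (algebraMap F K))
    (hdenom : ∀ m, g.denom.coeff m ∈ Set.range (algebraMap F K)) :
    ∃ f₀ : RatFunc F, extendScalars F K f₀ = g := by
  obtain ⟨p, hp⟩ := (lifts_iff_coeff_lifts _).2 hnum
  obtain ⟨q, hq⟩ := (lifts_iff_coeff_lifts _).2 hdenom
  refine ⟨algebraMap _ _ p / algebraMap _ _ q, ?_⟩
  change mapCoeffs (algebraMap F K) _ = g
  rw [map_div₀, mapCoeffs_algebraMap, mapCoeffs_algebraMap]
  rw [coe_mapRingHom] at hp hq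
  rw [hp, hq, RatFunc.num_div_denom]

theorem comap_extendScalars_pointInfty :
    (pointInfty K).comap (extendScalars F K) = pointInfty F := by
  have hX : (pointInfty K).valuation (extendScalars F K RatFunc.X) < 1 := by
    rw [show extendScalars F K RatFunc.X = RatFunc.X from mapCoeffs_X _]
    exact pointInfty_valuation_X
  have hX' : ((pointInfty K).comap (extendScalars F K)).valuation RatFunc.X < 1 :=
    (valuation_comap_lt_one_iff _ _ _).2 hX
  refine IsPoint.eq_of_adjoin_eq_top (k := F) ⟨fun a => ?_, fun h => ?_⟩ isPoint_pointInfty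
    RatFunc.X_ne_zero RatFunc.adjoin_X hX' pointInfty_valuation_X
  · rw [ValuationSubring.mem_comap,
      show extendScalars F K (algebraMap F _ a) = _ from mapCoeffs_C _ a]
    exact isPoint_pointInfty.1 _
  · rw [← ValuationSubring.mem_nonunits_iff, ValuationSubring.mem_nonunits_iff_or] at hX'
    refine hX'.elim RatFunc.X_ne_zero fun h' => h' ?_
    rw [h]
    exact ValuationSubring.mem_top _

/-- The field `F(t)` is linearly disjoint from `K` over `F`. -/
theorem linearIndepOn_extendScalars {s : Set (RatFunc F)} (hs : LinearIndepOn F id s) :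
    LinearIndepOn K (extendScalars F K) s := by
  classical
  rw [linearIndepOn_iff']
  intro T a hTs hsum x hx
  obtain ⟨d, hd⟩ := IsLocalization.exist_integer_multiples_of_finset (nonZeroDivisors F[X]) T
  have hd0 : algebraMap F[X] (RatFunc F) d ≠ 0 :=
    RatFunc.algebraMap_ne_zero (nonZeroDivisors.ne_zero d.2)
  have hp : ∀ y : RatFunc F, ∃ p : F[X], y ∈ T →
      algebraMap F[X] (RatFunc F) p = algebraMap F[X] (RatFunc F) d * y := by
    intro y
    by_cases hy : y ∈ T
    · obtain ⟨p, hp⟩ := hd y hy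
      exact ⟨p, fun _ => by rw [hp, Algebra.smul_def]⟩
    · exact ⟨0, fun h => absurd h hy⟩
  choose p hp using hp
  have h1 : ∑ y ∈ T, C (a y) * (p y).map (algebraMap F K) = 0 := by
    refine RatFunc.algebraMap_injective K ?_
    rw [map_zero, map_sum, ← mul_zero (extendScalars F K (algebraMap F[X] (RatFunc F) d)), ← hsum,
      Finset.mul_sum]
    refine Finset.sum_congr rfl fun y hy => ?_
    rw [map_mul, ← mapCoeffs_algebraMap, hp y hy, map_mul, RatFunc.algebraMap_C, Algebra.smul_def,
      RatFunc.algebraMap_eq_C]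
    change _ = _ * (_ * mapCoeffs (algebraMap F K) y)
    rw [mul_left_comm]
    rfl
  -- With denominators cleared, an `F`-linear functional on `K` applied to coefficients turns the
  -- relation over `K` into one over `F`. Functionals separate the elements of `K`.
  refine (Module.forall_dual_apply_eq_zero_iff F (a x)).1 fun φ => ?_
  have h2 : ∑ y ∈ T, C (φ (a y)) * p y = 0 := by
    ext m
    have h3 := congrArg (fun q : K[X] => φ (q.coeff m)) h1
    simp only [finsetSum_coeff, coeff_C_mul, coeff_map, coeff_zero, map_sum, map_zero] at h3 ⊢
    rw [← h3]
    refine Finset.sum_congr rfl fun y _ => ?_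
    rw [mul_comm (a y), ← Algebra.smul_def, map_smul, smul_eq_mul, mul_comm]
  have h4 : ∑ y ∈ T, φ (a y) • id y = 0 := by
    refine (mul_eq_zero.1 ?_).resolve_left hd0
    rw [Finset.mul_sum, ← map_zero (algebraMap F[X] (RatFunc F)), ← h2, map_sum]
    refine Finset.sum_congr rfl fun y hy => ?_
    rw [map_mul, hp y hy, RatFunc.algebraMap_C, Algebra.smul_def, RatFunc.algebraMap_eq_C, id,
      mul_left_comm]
  exact linearIndepOn_iff'.1 hs T _ hTs h4 x hx

theorem isDescent_of_extendScalars_eq {f : L} {P : ValuationSubring L} (hf : Transcendental K f)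
    {θ : L ≃ₐ[K] RatFunc K} (hθ : MapsPoint θ P (pointInfty K)) {f₀ : RatFunc F}
    (h : extendScalars F K f₀ = θ f) : IsDescent F K f₀ (pointInfty F) f P := by
  refine ⟨⟨isCurve_ratFunc, fun halg => hf ?_, isRationalPoint_pointInfty⟩, ?_⟩
  · obtain ⟨p, hp0, hp⟩ := halg
    refine ⟨p.map (algebraMap F K), (Polynomial.map_ne_zero_iff (algebraMap F K).injective).2 hp0,
      θ.injective ?_⟩
    rw [map_zero, ← aeval_algHom_apply θ f, ← h, aeval_def, eval₂_map]
    have h1 := congrArg (extendScalars F K) hp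
    rw [aeval_def, hom_eval₂, map_zero] at h1
    rw [← h1]
    congr 1
    ext a
    exact (mapCoeffs_C _ a).symm
  refine ⟨(θ.symm : RatFunc K →+* L).comp (extendScalars F K), ⟨fun a => ?_, fun s hs => ?_, ?_⟩,
    ?_, fun x => ?_⟩
  · change θ.symm (mapCoeffs _ _) = _
    rw [mapCoeffs_C, θ.symm.commutes]
  · have h1 := (linearIndepOn_extendScalars (K := K) hs).map_injOn
      (θ.symm : RatFunc K →ₗ[K] L) θ.symm.injective.injOn
    exact h1
  · have h1 : (⊤ : IntermediateField K L) = (K⟮(RatFunc.X : RatFunc K)⟯).map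
        (θ.symm : RatFunc K →ₐ[K] L) := by
      rw [RatFunc.adjoin_X, ← AlgHom.fieldRange_eq_map, eq_comm]
      exact AlgHom.fieldRange_eq_top.2 θ.symm.surjective
    rw [eq_top_iff, h1, adjoin_map, Set.image_singleton, adjoin_simple_le_iff]
    refine subset_adjoin K _ ⟨RatFunc.X, ?_⟩
    change θ.symm (mapCoeffs _ _) = _
    rw [mapCoeffs_X]
    rfl
  · rw [RingHom.comp_apply, h]
    exact θ.symm_apply_apply f
  · rw [← comap_extendScalars_pointInfty (F := F) (K := K), ValuationSubring.mem_comap, hθ]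
    change _ ↔ θ (θ.symm _) ∈ _
    rw [θ.apply_symm_apply]

end Descent

/-! ### Coefficients fixed by the relevant automorphisms lie in `F` -/

section Moduli

variable {F K L : Type*} [Field F] [Field K] [Algebra F K] [Field L] [Algebra K L]

theorem mem_range_of_fieldOfModuli_eq_bot {f : L} (hmoduli : fieldOfModuli F K f = ⊥) {a : K}
    (ha : ∀ σ : K ≃ₐ[F] K, IsConjIso σ f → σ a = a) : a ∈ Set.range (algebraMap F K) := by
  have h : a ∈ fieldOfModuli F K f := ha
  rwa [hmoduli, IntermediateField.mem_bot] at h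

theorem coeffAt_mapCoeffs {k : Type*} [Field k] (σ : k →+* k) (f : RatFunc k) (m : ℤ) :
    coeffAt (mapCoeffs σ f) m = σ (coeffAt f m) := by
  have := coeffAt_apply (ψ := mapCoeffs σ) (a := 1) (mapCoeffs_C σ)
    (by rw [mapCoeffs_X, Units.val_one, map_one, one_mul]) f m
  rwa [Units.val_one, one_zpow, one_mul] at this

theorem exists_extendScalars_eq_of_fieldOfModuli_eq_bot {f : L}
    (hmoduli : fieldOfModuli F K f = ⊥) {g : RatFunc K}
    (hg : ∀ σ : K ≃ₐ[F] K, IsConjIso σ f → ∀ m, σ (coeffAt g m) = coeffAt g m) :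
    ∃ f₀ : RatFunc F, extendScalars F K f₀ = g := by
  have key : ∀ σ : K ≃ₐ[F] K, IsConjIso σ f → mapCoeffs (σ : K →+* K) g = g := fun σ hσ =>
    coeffAt_injective fun m => (coeffAt_mapCoeffs _ _ _).trans (hg σ hσ m)
  refine exists_extendScalars_eq (fun m => ?_) fun m => ?_
  · refine mem_range_of_fieldOfModuli_eq_bot hmoduli fun σ hσ => ?_
    have := congrArg (fun p : K[X] => p.coeff m) (num_map_denom_map_of_mapCoeffs_eq (key σ hσ)).1
    simpa using this
  · refine mem_range_of_fieldOfModuli_eq_bot hmoduli fun σ hσ => ?_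
    have := congrArg (fun p : K[X] => p.coeff m) (num_map_denom_map_of_mapCoeffs_eq (key σ hσ)).2
    simpa using this

end Moduli

end LaxBelyi

/-! ### The main theorem -/

theorem mainTheorem12 {F K L : Type*} [Field F] [CharZero F] [Field K] [Algebra F K]
    [IsSepClosure F K] [Field L] [Algebra K L]
    (f : L) (P : ValuationSubring L) (n : ℕ)
    (hmarked : LaxBelyi.IsMarkedMap K f P)
    (hgenus : LaxBelyi.genus K L = 0)
    (hlax : LaxBelyi.IsLaxBelyi K f)
    (hgalois : LaxBelyi.IsGaloisMap K f)
    (hmoduli : LaxBelyi.fieldOfModuli F K f = ⊥)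
    (hn : 2 ≤ n)
    (hram : LaxBelyi.HasRamificationIndex K f P ((0 : K) : OnePoint K) n) :
    (∃ θ : L ≃ₐ[K] RatFunc K, LaxBelyi.IsModel f P n θ) ∧
    ∀ θ : L ≃ₐ[K] RatFunc K, LaxBelyi.IsModel f P n θ →
      (∀ m : ℤ, LaxBelyi.coeffAt (θ f) m ≠ 0 → ∃ i : ℕ, 1 ≤ i ∧ m = i * n) ∧
      ∃ c : ℕ → K, (∀ i : ℕ, c i = LaxBelyi.coeffAt (θ f) (i * n)) ∧
        (∃ I : Finset ℕ, (∀ i ∈ I, 1 ≤ i ∧ c i ≠ 0) ∧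
          AddSubgroup.closure ((fun i : ℕ => (i : ℤ)) '' (I : Set ℕ)) = ⊤) ∧
        ∀ I : Finset ℕ, (∀ i ∈ I, 1 ≤ i ∧ c i ≠ 0) →
          AddSubgroup.closure ((fun i : ℕ => (i : ℤ)) '' (I : Set ℕ)) = ⊤ →
          ∀ b : ℕ → ℤ, ∑ i ∈ I, b i * (i : ℤ) = 1 →
            (∃ c₀ : ℕ → K, LaxBelyi.IsNormalizedRepr I b c c₀) ∧
            ∀ c₀ : ℕ → K, LaxBelyi.IsNormalizedRepr I b c c₀ →
              (∃ α : Kˣ, ∀ i ∈ I, c₀ i = (α : K) ^ (i * n) * c i) ∧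
              (∀ α β : Kˣ, (∀ i ∈ I, c₀ i = (α : K) ^ (i * n) * c i) →
                ((∀ i ∈ I, c₀ i = (β : K) ^ (i * n) * c i) ↔
                  ∃ ξ : Kˣ, ξ ^ n = 1 ∧ β = ξ * α)) ∧
              ∀ α : Kˣ, (∀ i ∈ I, c₀ i = (α : K) ^ (i * n) * c i) →
                (∀ m : ℤ, LaxBelyi.coeffAt (LaxBelyi.scale α (θ f)) m ∈
                  Set.range (algebraMap F K)) ∧
                (∀ i ∈ I, LaxBelyi.coeffAt (LaxBelyi.scale α (θ f)) (i * n) = c₀ i) ∧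
                ∃ f₀ : RatFunc F,
                  LaxBelyi.extendScalars F K f₀ = LaxBelyi.scale α (θ f) ∧
                  LaxBelyi.IsDescent F K f₀ (LaxBelyi.pointInfty F) f P := by
  have : IsSepClosed K := IsSepClosure.sep_closed F
  have : CharZero K := charZero_of_injective_algebraMap (algebraMap F K).injective
  have hn0 : n ≠ 0 := by omega
  have hf0 : f ≠ 0 := by
    rintro rfl
    exact hmarked.nonconstant isAlgebraic_zero
  have hparam : LaxBelyi.pullbackParam K f ((0 : K) : OnePoint K) = f := by
    change f - algebraMap K L 0 = f
    rw [map_zero, sub_zero]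
  obtain ⟨hmaps, hord⟩ := hram
  rw [LaxBelyi.MapsTo, hparam, ValuationSubring.mem_nonunits_iff] at hmaps
  rw [hparam] at hord
  refine ⟨LaxBelyi.exists_isModel hmarked hgenus hgalois hn0 hord, fun θ hθ => ⟨fun m hm =>
    LaxBelyi.coeffAt_ne_zero_imp hmaps hθ hm, fun i => LaxBelyi.coeffAt (θ f) (i * n),
    fun _ => rfl, ?_, ?_⟩⟩
  · obtain ⟨I, hI, htop⟩ := LaxBelyi.exists_finset_closure_eq_top
      (LaxBelyi.closure_support_eq_top hn0 hmaps hf0 hθ)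
    exact ⟨I, fun i hi => hI hi, htop⟩
  intro I hI _ b hb
  have hc : ∀ i ∈ I, LaxBelyi.coeffAt (θ f) (i * n) ≠ 0 := fun i hi => (hI i hi).2
  refine ⟨LaxBelyi.exists_isNormalizedRepr hb hc, fun c₀ hc₀ => ⟨hc₀.exists_scaling hn0,
    fun α β hα => LaxBelyi.scaling_iff hb hc hα, fun α hα => ?_⟩⟩
  have hcoeff : ∀ i ∈ I, LaxBelyi.coeffAt (LaxBelyi.scale α (θ f)) (i * n) = c₀ i := by
    intro i hi
    have h : (α : K) ^ ((i : ℤ) * n) = (α : K) ^ (i * n) := by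
      rw [← Nat.cast_mul, zpow_natCast]
    rw [LaxBelyi.coeffAt_scale, hα i hi, h]
  have hnorm : ∏ i ∈ I, LaxBelyi.coeffAt (LaxBelyi.scale α (θ f)) (i * n) ^ b i = 1 := by
    rw [← hc₀.2]
    exact Finset.prod_congr rfl fun i hi => by rw [hcoeff i hi]
  have hfix : ∀ σ : K ≃ₐ[F] K, LaxBelyi.IsConjIso σ f → ∀ m,
      σ (LaxBelyi.coeffAt (LaxBelyi.scale α (θ f)) m) =
        LaxBelyi.coeffAt (LaxBelyi.scale α (θ f)) m := fun σ hσ =>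
    hσ.apply_coeffAt_scale_eq hn hmarked.rational.1 hf0 hmaps hgalois hθ hb hnorm
  obtain ⟨f₀, hf₀⟩ := LaxBelyi.exists_extendScalars_eq_of_fieldOfModuli_eq_bot hmoduli hfix
  refine ⟨fun m => LaxBelyi.mem_range_of_fieldOfModuli_eq_bot hmoduli fun σ hσ => hfix σ hσ m,
    hcoeff, f₀, hf₀, ?_⟩
  -- The base change of `f₀` is `f` read in the rescaled model, which still takes `P` to `t = 0`.
  exact LaxBelyi.isDescent_of_extendScalars_eq (θ := θ.trans (LaxBelyi.scale α))
    hmarked.nonconstant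
    (fun x => (hθ.1 x).trans (LaxBelyi.mem_pointInfty_iff_scale α (θ x))) hf₀
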